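/- Let $H_+=\{x=(x_j)_{j\ge 0}\in\ell^2 : x_j\ge 0 \text{ for all } j\ge 1\}$. For $T>0$, $\sigma\in[0,\infty)$ and $c\in[1,3)$ consider on $[0,T]$ the stochastic dyadic system $$du_0=-u_0u_1\,dt+\sigma\,dW(t),\qquad du_j=\bigl(-2^{cj}u_ju_{j+1}+2^{c(j-1)}u_{j-1}^2\bigr)dt\quad (j\ge 1),\qquad u(0)=\underline u,$$ where $W=(W(t))_{t\ge 0}$ is a one-dimensional Brownian motion that is, on $[0,T]$, a Brownian motion with respect to a filtration $(\mathcal F_t)_{t\in[0,T]}$ of a probability space $(\Omega,\mathcal F,\mathbb P)$, and $\underline u$ is an $\mathcal F_0$-measurable random variable with values in $H_+$ almost surely; the first equation means $u_0(t)=u_0(0)-\int_0^t u_0(s)u_1(s)\,ds+\sigma W(t)$. A *strong solution* is an $\ell^2$-valued process $u=(u(t))_{t\in[0,T]}$ which is adapted to the (completed) filtration generated by $W$ and $\underline u$ and which almost surely has continuous components $u_j$, takes values in $H_+$ for all $t\in[0,T]$, and satisfies the system. It is a *strong stationary solution* if moreover the distribution of $u(t)$ on $\ell^2$ does not depend on $t\in[0,T]$.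 It is in $L^2(\Omega,H_+)$ if, for every $t\in[0,T]$, $u(t)\in H_+$ almost surely and $\mathbb E\|u(t)\|_{\ell^2}^2<\infty$. **Theorem (uniqueness of the stationary distribution).** Let $T>0$, $\sigma\ge 0$ and $c\in[1,3)$. If $u_1^*$ and $u_2^*$ are strong stationary solutions in $L^2(\Omega,H_+)$ of the system with these parameters, possibly on different probability spaces and with different filtrations, Brownian motions and initial conditions, then $u_1^*$ and $u_2^*$ have the same distribution: for every $t\in[0,T]$ the random variables $u_1^*(t)$ and $u_2^*(t)$ have the same law on $\ell^2$, and the processes $(u_1^*(t))_{t\in[0,T]}$ and $(u_2^*(t))_{t\in[0,T]}$ have the same law on $(\ell^2)^{[0,T]}$ with the product $\sigma$-algebra. -/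

import Mathlib

open MeasureTheory ProbabilityTheory Set
open scoped NNReal ENNReal

namespace Dyadic

noncomputable section

/-- The real sequence space `ℓ²`, with its Hilbert norm. -/
abbrev EllTwo : Type := lp (fun _ : ℕ => ℝ) 2

/-- `ℓ²` carries its Borel σ-algebra. -/
instance instMeasurableSpaceEllTwo : MeasurableSpace EllTwo := borel EllTwo

instance instBorelSpaceEllTwo : BorelSpace EllTwo := ⟨rfl⟩

/-- `H_+`: the sequences in `ℓ²` whose components of index `j ≥ 1` are nonnegative. -/
def Hplus : Set EllTwo := {x | ∀ j : ℕ, 1 ≤ j → 0 ≤ x j}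

/-- `v` is a solution on `[0, T]` of the dyadic system with initial condition `x` and with the
scalar path `w` as noise acting on the component `0`: the components are continuous, `v` takes
values in `H_+`, the component `0` satisfies the integral equation
`v₀(t) = v₀(0) - ∫₀ᵗ v₀ v₁ ds + σ w(t)`, and the components `j ≥ 1` satisfy
`v_j' = - 2^{cj} v_j v_{j+1} + 2^{c(j-1)} v_{j-1}²` (one-sided derivatives at `0` and `T`). -/
structure IsPathSolution (c σ T : ℝ) (x : EllTwo) (w : ℝ → ℝ) (v : ℝ → EllTwo) : Prop where
  initial : v 0 = x
  continuousOn : ∀ j : ℕ, ContinuousOn (fun t => v t j) (Icc 0 T)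
  mem_Hplus : ∀ t ∈ Icc (0 : ℝ) T, v t ∈ Hplus
  eq_zero : ∀ t ∈ Icc (0 : ℝ) T,
    v t 0 = v 0 0 - (∫ s in (0 : ℝ)..t, v s 0 * v s 1) + σ * w t
  eq_pos : ∀ j : ℕ, 1 ≤ j → ∀ t ∈ Icc (0 : ℝ) T,
    HasDerivWithinAt (fun s => v s j)
      (-((2 : ℝ) ^ (c * (j : ℝ)) * v t j * v t (j + 1))
        + (2 : ℝ) ^ (c * ((j : ℝ) - 1)) * (v t (j - 1)) ^ 2)
      (Icc 0 T) t

/-- `W` is a standard real Brownian motion with respect to the filtration `(𝓕 t)`, `0 ≤ t ≤ T`: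
it is a Brownian motion, it is adapted, and its increments after time `s` are independent of `𝓕 s`.
Nothing is required of the filtration after time `T`. -/
structure IsBrownianWrt {Ω : Type*} [mΩ : MeasurableSpace Ω] (T : ℝ≥0) (P : Measure Ω)
    (𝓕 : Filtration ℝ≥0 mΩ) (W : ℝ≥0 → Ω → ℝ) : Prop where
  isBrownian : IsBrownianReal W P
  adapted : ∀ t ≤ T, Measurable[𝓕 t] (W t)
  indep : ∀ s t : ℝ≥0, s ≤ t → t ≤ T →
    Indep (MeasurableSpace.comap (fun ω => W t ω - W s ω) inferInstance) (𝓕 s) P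

/-- The σ-algebra generated by the initial condition `ξ` and by `W s`, `s ≤ t`. -/
abbrev generatedSigma {Ω : Type*} (W : ℝ≥0 → Ω → ℝ) (ξ : Ω → EllTwo) (t : ℝ≥0) :
    MeasurableSpace Ω :=
  MeasurableSpace.comap ξ inferInstance ⊔
    ⨆ s : ℝ≥0, ⨆ _ : s ≤ t, MeasurableSpace.comap (W s) inferInstance

/-- `u` is a strong solution on `[0, T]` with Brownian motion `W` (relative to `𝓕`) and
`𝓕 0`-measurable initial condition `ξ`. Adaptedness to the filtration generated by `ξ` and `W`
is understood up to `P`-null sets, that is, relative to the completed filtration; this is implied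
by adaptedness to the uncompleted one. -/
structure IsStrongSolution {Ω : Type*} [mΩ : MeasurableSpace Ω]
    (c : ℝ) (σ T : ℝ≥0) (P : Measure Ω) (𝓕 : Filtration ℝ≥0 mΩ)
    (W : ℝ≥0 → Ω → ℝ) (ξ : Ω → EllTwo) (u : ℝ≥0 → Ω → EllTwo) : Prop where
  brownian : IsBrownianWrt T P 𝓕 W
  initial_measurable : Measurable[𝓕 0] ξ
  measurable : ∀ t ≤ T, Measurable (u t)
  adapted : ∀ t ≤ T, ∃ v : Ω → EllTwo, Measurable[generatedSigma W ξ t] v ∧ u t =ᵐ[P] v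
  solves : ∀ᵐ ω ∂P, IsPathSolution c σ T (ξ ω)
    (fun s : ℝ => W s.toNNReal ω) (fun s : ℝ => u s.toNNReal ω)

/-- A strong stationary solution: a strong solution whose law at time `t` does not depend on
`t ∈ [0, T]`. -/
structure IsStrongStationarySolution {Ω : Type*} [mΩ : MeasurableSpace Ω]
    (c : ℝ) (σ T : ℝ≥0) (P : Measure Ω)
    (𝓕 : Filtration ℝ≥0 mΩ) (W : ℝ≥0 → Ω → ℝ) (ξ : Ω → EllTwo)
    (u : ℝ≥0 → Ω → EllTwo) : Prop where
  strong : IsStrongSolution c σ T P 𝓕 W ξ u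
  stationary : ∀ s ≤ T, ∀ t ≤ T, P.map (u s) = P.map (u t)

/-- `u ∈ L²(Ω, H_+)`: at each time in `[0, T]` the process is a.s. `H_+`-valued and its
`ℓ²`-norm has finite second moment. -/
def InL2Hplus {Ω : Type*} [mΩ : MeasurableSpace Ω] (T : ℝ≥0) (P : Measure Ω)
    (u : ℝ≥0 → Ω → EllTwo) : Prop :=
  ∀ t ≤ T, (∀ᵐ ω ∂P, u t ω ∈ Hplus) ∧ MemLp (u t) 2 P

end

end Dyadic

/-! Drive two solutions by the same noise. The noise cancels in the difference of the components
`0`, and in the norm with weights `2^{-j}` the exchange terms between neighbouring components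
telescope, because halving the weight absorbs the factor `2` in front of the incoming exchange
(`weighted_balance`). With `r = 2^c`, there remain the dissipations `r^j ∫ (u_j - v_j)² (u_{j+1} +
v_{j+1}) ≥ 0` and a boundary term, `2^{-n}` times the exchange at level `n`. Its harmful part tends
to `0` because `r^j ∫ u_j³` is bounded uniformly in `j ≥ 1` (`exists_cubeIntegral_bound`), a
pathwise estimate needing only a continuous component `0` and square-summable initial data.

So the weighted distance at time `T` is at most the initial one. If the two are equal (and finite),
every dissipation vanishes, and the equations then force the two paths to agree on all of `[0, T]`
(`eqOn_of_weightedSq_eq`).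

The probabilistic half is an optimal transport argument. Take a coupling of the two stationary laws
with least expected weighted squared distance; this cost is finite by the second moments. Start the
two solutions from it with one common noise, independent of the initial pair (`exists_gluing`). By
stationarity the time-`T` values again form a coupling of the same laws, so the expected distance
cannot have dropped below the minimum; by contraction it has not grown. Hence the distances are
almost surely equal, the paths coincide, and their laws agree (`map_snd_eq_of_contracting`). -/

namespace Dyadic

open Filter Topology

/-! ### Energy balance of a single solution -/

/-- The drift of the component `j + 1`, with the coefficients `2 ^ (c * j)` written `r ^ j`. -/
def drift (r : ℝ) (v : ℕ → ℝ → ℝ) (j : ℕ) (s : ℝ) : ℝ :=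
  -(r ^ (j + 1) * v (j + 1) s * v (j + 2) s) + r ^ j * v j s ^ 2

/-- The components of index at least `1` are nonnegative and solve the dyadic system on `[0, T]`,
driven by the continuous component `0`. -/
structure IsTailSolution (r T : ℝ) (x : ℕ → ℝ) (v : ℕ → ℝ → ℝ) : Prop where
  continuous : ∀ j, Continuous (v j)
  nonneg : ∀ j t, 0 ≤ v (j + 1) t
  eq_succ : ∀ j, ∀ t ∈ Icc 0 T, v (j + 1) t = x (j + 1) + ∫ s in (0 : ℝ)..t, drift r v j s

theorem hasDerivAt_of_eqOn_integral {T a : ℝ} {f g : ℝ → ℝ} (hg : Continuous g)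
    (h : ∀ t ∈ Icc 0 T, f t = a + ∫ s in (0 : ℝ)..t, g s) {t : ℝ} (ht : t ∈ Ioo 0 T) :
    HasDerivAt f (g t) t := by
  have h1 : HasDerivAt (fun t => a + ∫ s in (0 : ℝ)..t, g s) (g t) t :=
    (intervalIntegral.integral_hasDerivAt_right (hg.intervalIntegrable _ _)
      hg.stronglyMeasurable.stronglyMeasurableAtFilter hg.continuousAt).const_add a
  refine h1.congr_of_eventuallyEq ?_
  filter_upwards [Ioo_mem_nhds ht.1 ht.2] with s hs using h s (Ioo_subset_Icc_self hs)

theorem integral_eq_sub_of_hasDerivAt_Ioo {T : ℝ} {f g : ℝ → ℝ} (hf : Continuous f)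
    (hg : Continuous g) (h : ∀ t ∈ Ioo 0 T, HasDerivAt f (g t) t) {t : ℝ} (ht : t ∈ Icc 0 T) :
    ∫ s in (0 : ℝ)..t, g s = f t - f 0 :=
  intervalIntegral.integral_eq_sub_of_hasDerivAt_of_le ht.1 hf.continuousOn
    (fun s hs => h s ⟨hs.1, hs.2.trans_le ht.2⟩) (hg.intervalIntegrable _ _)

/-- The time integral of the energy flux from the component `j` to the component `j + 1`. -/
noncomputable def flux (r : ℝ) (v : ℕ → ℝ → ℝ) (j : ℕ) (t : ℝ) : ℝ :=
  r ^ j * ∫ s in (0 : ℝ)..t, v j s ^ 2 * v (j + 1) s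

namespace IsTailSolution

variable {r T : ℝ} {x : ℕ → ℝ} {v : ℕ → ℝ → ℝ}

theorem continuous_drift (h : IsTailSolution r T x v) (j : ℕ) : Continuous (drift r v j) := by
  have := h.continuous
  unfold drift
  fun_prop

theorem initial (h : IsTailSolution r T x v) (hT : 0 ≤ T) (j : ℕ) : v (j + 1) 0 = x (j + 1) := by
  simpa using h.eq_succ j 0 ⟨le_rfl, hT⟩

theorem hasDerivAt (h : IsTailSolution r T x v) (j : ℕ) {t : ℝ} (ht : t ∈ Ioo 0 T) :
    HasDerivAt (v (j + 1)) (drift r v j t) t :=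
  hasDerivAt_of_eqOn_integral (h.continuous_drift j) (h.eq_succ j) ht

theorem flux_nonneg (h : IsTailSolution r T x v) (hr : 0 ≤ r) (j : ℕ) {t : ℝ} (ht : 0 ≤ t) :
    0 ≤ flux r v j t :=
  mul_nonneg (pow_nonneg hr j) (intervalIntegral.integral_nonneg ht
    fun s _ => mul_nonneg (sq_nonneg _) (h.nonneg j s))

theorem flux_mono (h : IsTailSolution r T x v) (hr : 0 ≤ r) (j : ℕ) {s t : ℝ} (hs : 0 ≤ s)
    (hst : s ≤ t) : flux r v j s ≤ flux r v j t := by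
  have hc := h.continuous
  have hi : Continuous fun s => v j s ^ 2 * v (j + 1) s := by fun_prop
  refine mul_le_mul_of_nonneg_left ?_ (pow_nonneg hr j)
  exact intervalIntegral.integral_mono_interval le_rfl hs hst
    (Eventually.of_forall fun s => mul_nonneg (sq_nonneg _) (h.nonneg j s))
    (hi.intervalIntegrable _ _)

theorem sq_eq (h : IsTailSolution r T x v) (j : ℕ) {t : ℝ} (ht : t ∈ Icc 0 T) :
    v (j + 1) t ^ 2 = x (j + 1) ^ 2 + 2 * (flux r v j t - flux r v (j + 1) t) := by
  have hc := h.continuous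
  have hd := h.continuous_drift j
  have h1 := integral_eq_sub_of_hasDerivAt_Ioo (f := fun s => v (j + 1) s ^ 2)
    (g := fun s => 2 * v (j + 1) s * drift r v j s) (by fun_prop) (by fun_prop)
    (fun s hs => by simpa using (h.hasDerivAt j hs).fun_pow 2) ht
  have h2 : ∫ s in (0 : ℝ)..t, 2 * v (j + 1) s * drift r v j s
      = 2 * (flux r v j t - flux r v (j + 1) t) := by
    have e : ∀ s, 2 * v (j + 1) s * drift r v j s
        = 2 * (r ^ j * (v j s ^ 2 * v (j + 1) s)
          - r ^ (j + 1) * (v (j + 1) s ^ 2 * v (j + 1 + 1) s)) := by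
      intro s; simp only [drift]; ring
    simp only [e, flux]
    rw [intervalIntegral.integral_const_mul, intervalIntegral.integral_sub,
      intervalIntegral.integral_const_mul, intervalIntegral.integral_const_mul]
    all_goals exact Continuous.intervalIntegrable (by fun_prop) _ _
  have h3 := h.initial (ht.1.trans ht.2) j
  simp only [h3] at h1
  linarith

/-- The fluxes telescope. The only energy source left is the flux out of component `0`, so the noise
enters through `flux r v 0` alone. -/
theorem energy_balance (h : IsTailSolution r T x v) (n : ℕ) {t : ℝ} (ht : t ∈ Icc 0 T) :
    ∑ j ∈ Finset.range n, v (j + 1) t ^ 2 + 2 * flux r v n t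
      = ∑ j ∈ Finset.range n, x (j + 1) ^ 2 + 2 * flux r v 0 t := by
  induction n with
  | zero => simp
  | succ n ih =>
    rw [Finset.sum_range_succ, Finset.sum_range_succ, h.sq_eq n ht]
    linarith

theorem exists_energy_bound (h : IsTailSolution r T x v) (hr : 0 ≤ r) (hT : 0 ≤ T)
    {B : ℝ} (hB : ∀ n, ∑ j ∈ Finset.range n, x j ^ 2 ≤ B) :
    ∃ M : ℝ, 0 ≤ M ∧ (∀ j, flux r v j T ≤ M) ∧ ∀ j, ∀ t ∈ Icc 0 T, v (j + 1) t ≤ M := by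
  have hB' : ∀ n, ∑ j ∈ Finset.range n, x (j + 1) ^ 2 ≤ B := fun n => by
    have := hB (n + 1)
    rw [Finset.sum_range_succ'] at this
    linarith [sq_nonneg (x 0)]
  have hB0 : 0 ≤ B := by simpa using hB 0
  have hF := h.flux_nonneg hr 0 hT
  -- The energy bounds squares by `B + 2 * flux r v 0 T`; the summand `1` turns this into a bound on
  -- `v` itself through `2v ≤ 1 + v²`.
  refine ⟨1 + B + 2 * flux r v 0 T, by linarith, fun j => ?_, fun j t ht => ?_⟩
  · have := h.energy_balance j (right_mem_Icc.2 hT)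
    have h2 : 0 ≤ ∑ i ∈ Finset.range j, v (i + 1) T ^ 2 :=
      Finset.sum_nonneg fun _ _ => sq_nonneg _
    linarith [hB' j]
  · have := h.energy_balance (j + 1) ht
    have h2 : 0 ≤ ∑ i ∈ Finset.range j, v (i + 1) t ^ 2 :=
      Finset.sum_nonneg fun _ _ => sq_nonneg _
    rw [Finset.sum_range_succ] at this
    have h3 := h.flux_nonneg hr (j + 1) ht.1
    have h4 := h.flux_mono hr 0 ht.1 ht.2
    nlinarith [hB' (j + 1), sq_nonneg (v (j + 1) t - 1)]

end IsTailSolution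

/-! ### Uniform bound on the weighted cube integrals -/

/-- The time integral over `[0, T]` of the cube of the component `j`, weighted by `r ^ j`. -/
noncomputable def cubeIntegral (r T : ℝ) (v : ℕ → ℝ → ℝ) (j : ℕ) : ℝ :=
  r ^ j * ∫ s in (0 : ℝ)..T, v j s ^ 3

theorem four_mul_mul_sq_le {p a b : ℝ} (hb : 0 ≤ b) :
    4 * p * (a * b ^ 2) ≤ 4 * p ^ 2 * (a ^ 2 * b) + b ^ 3 := by
  nlinarith [mul_nonneg hb (sq_nonneg (2 * p * a - b))]

/-- Two weighted Young inequalities in a row: the triple product is traded for the flux densities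
`a²b` and `b²e`, whose integrals the energy controls, and a cube with coefficient small compared
with `4p`. -/
theorem four_mul_mul_mul_le {p a b e : ℝ} (hp : 1 ≤ p) (hb : 0 ≤ b) (he : 0 ≤ e) :
    4 * p * (a * b * e) ≤ 4 * p ^ 2 * (a ^ 2 * b) + p * (b ^ 2 * e) + e ^ 3 := by
  have h1 : 4 * p * (a * b * e) ≤ 4 * p ^ 2 * (a ^ 2 * b) + b * e ^ 2 := by
    nlinarith [mul_nonneg hb (sq_nonneg (2 * p * a - e))]
  have h2 := four_mul_mul_sq_le (p := p) (a := b) he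
  have h3 : 0 ≤ e ^ 3 := by positivity
  have h4 : 4 * p * (b * e ^ 2) ≤ 4 * p * (p * (b ^ 2 * e) + e ^ 3) := by nlinarith
  have h5 := le_of_mul_le_mul_left h4 (by linarith)
  linarith

/-- Growth at most like `r ^ n` suffices for an upward recursion to close: each use of it multiplies
the excess over `2C` by at most `(r + r²) / (4r²) ≤ 1/2`, so iterating removes the a priori bound.
-/
theorem le_of_forall_two_step_bound {r C K : ℝ} {X : ℕ → ℝ} (hr : 1 ≤ r) (hC : 0 ≤ C)
    (hX : ∀ n, X n ≤ K * r ^ n)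
    (h : ∀ n, 4 * r ^ 2 * X n ≤ 4 * r ^ 2 * C + (X (n + 1) + X (n + 2))) (n : ℕ) :
    X n ≤ 2 * C := by
  have hK : 0 ≤ |K| := abs_nonneg K
  have key : ∀ m n, X n ≤ 2 * C + (1 / 2) ^ m * (|K| * r ^ n) := by
    intro m
    induction m with
    | zero =>
      intro n
      have : K * r ^ n ≤ |K| * r ^ n := by gcongr; exact le_abs_self K
      linarith [hX n]
    | succ m ih =>
      intro n
      have h1 := ih (n + 1)
      have h2 := ih (n + 2)
      have h3 := h n
      set q : ℝ := (1 / 2) ^ m * (|K| * r ^ n) with hq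
      have hq0 : 0 ≤ q := by positivity
      have e1 : (1 / 2 : ℝ) ^ m * (|K| * r ^ (n + 1)) = r * q := by rw [hq]; ring
      have e2 : (1 / 2 : ℝ) ^ m * (|K| * r ^ (n + 2)) = r ^ 2 * q := by rw [hq]; ring
      have e3 : (1 / 2 : ℝ) ^ (m + 1) * (|K| * r ^ n) = q / 2 := by rw [hq]; ring
      rw [e1] at h1
      rw [e2] at h2
      rw [e3]
      have hr2 : r ≤ r ^ 2 := by nlinarith
      have h5 : r * q ≤ r ^ 2 * q := mul_le_mul_of_nonneg_right hr2 hq0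
      have h6 : C ≤ r ^ 2 * C := le_mul_of_one_le_left hC (by nlinarith)
      have h4 : 4 * r ^ 2 * X n ≤ 4 * r ^ 2 * (2 * C + q / 2) := by nlinarith
      exact le_of_mul_le_mul_left h4 (by positivity)
  have ht : Tendsto (fun m : ℕ => 2 * C + (1 / 2 : ℝ) ^ m * (|K| * r ^ n)) atTop
      (𝓝 (2 * C + 0 * (|K| * r ^ n))) :=
    ((tendsto_pow_atTop_nhds_zero_of_lt_one (by norm_num) (by norm_num)).mul_const _).const_add _
  have := ge_of_tendsto' ht fun m => key m n
  simpa using this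

namespace IsTailSolution

variable {r T : ℝ} {x : ℕ → ℝ} {v : ℕ → ℝ → ℝ}

/-- The cube `r^{n+1} v_{n+1}³` appears in the derivative of `v_{n+1} v_{n+2}`, whose integral is a
bounded boundary term. The negative terms of that derivative are absorbed by Young's inequality into
fluxes and small multiples of the next two cubes. -/
theorem cubeIntegral_le_of_bound (h : IsTailSolution r T x v) (hr : 1 ≤ r) (hT : 0 ≤ T) {M : ℝ}
    (hM : 0 ≤ M) (hF : ∀ j, flux r v j T ≤ M) (hv : ∀ j, ∀ t ∈ Icc 0 T, v (j + 1) t ≤ M) (n : ℕ) :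
    4 * r ^ 2 * cubeIntegral r T v (n + 1) ≤
      4 * r ^ 2 * (M ^ 2 + (r ^ 2 + r ^ 3) * M + r * M) +
        (cubeIntegral r T v (n + 2) + cubeIntegral r T v (n + 3)) := by
  have hc := h.continuous
  have hd := h.continuous_drift
  have hr0 : 0 ≤ r := by linarith
  have h1 := integral_eq_sub_of_hasDerivAt_Ioo (f := fun s => v (n + 1) s * v (n + 2) s)
    (g := fun s => drift r v n s * v (n + 2) s + v (n + 1) s * drift r v (n + 1) s)
    (by fun_prop) (by fun_prop)
    (fun s hs => (h.hasDerivAt n hs).fun_mul (h.hasDerivAt (n + 1) hs)) (right_mem_Icc.2 hT)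
  have h2 : v (n + 1) T * v (n + 2) T - v (n + 1) 0 * v (n + 2) 0 ≤ M ^ 2 := by
    have a := hv n T (right_mem_Icc.2 hT)
    have b := hv (n + 1) T (right_mem_Icc.2 hT)
    have := mul_le_mul a b (h.nonneg _ _) hM
    have := mul_nonneg (h.nonneg n 0) (h.nonneg (n + 1) 0)
    simp only [Nat.add_assoc, Nat.reduceAdd] at *
    nlinarith
  have hp : ∀ s, 4 * r ^ 2 * (r ^ (n + 1) * v (n + 1) s ^ 3) ≤
      4 * r ^ 2 * (drift r v n s * v (n + 2) s + v (n + 1) s * drift r v (n + 1) s)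
        + 4 * r ^ 2 * (r ^ 2 + r ^ 3) * (r ^ (n + 1) * (v (n + 1) s ^ 2 * v (n + 2) s))
        + r ^ 2 * (r ^ (n + 2) * (v (n + 2) s ^ 2 * v (n + 3) s))
        + r ^ (n + 2) * v (n + 2) s ^ 3 + r ^ (n + 3) * v (n + 3) s ^ 3 := by
    intro s
    have ha : 0 ≤ v (n + 1) s := h.nonneg _ _
    have hb : 0 ≤ v (n + 2) s := h.nonneg _ _
    have he : 0 ≤ v (n + 3) s := h.nonneg _ _
    simp only [drift, Nat.add_assoc, Nat.reduceAdd]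
    have hR : 0 ≤ r ^ n := by positivity
    rw [show r ^ (n + 1) = r ^ n * r by ring, show r ^ (n + 2) = r ^ n * r ^ 2 by ring,
      show r ^ (n + 3) = r ^ n * r ^ 3 by ring]
    generalize v (n + 1) s = a at *
    generalize v (n + 2) s = b at *
    generalize v (n + 3) s = e at *
    generalize v n s = z at *
    generalize r ^ n = R at *
    -- The parameter `p = r²` makes the coefficients of the cubes at levels `n + 2` and `n + 3` at
    -- most `1` against `4r²` at level `n + 1`.
    have i1 := mul_le_mul_of_nonneg_left
      (four_mul_mul_sq_le (p := r ^ 2) (a := a) hb)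
      (by positivity : 0 ≤ R * r)
    have i2 := mul_le_mul_of_nonneg_left
      (four_mul_mul_mul_le (p := r ^ 2) (a := a) (by nlinarith) hb he)
      (by positivity : 0 ≤ R * r ^ 2)
    -- The inflow from component `n` has the favourable sign and is dropped; for `n = 0` this
    -- matters, as component `0` has no sign and only its square occurs.
    have i3 : 0 ≤ 4 * r ^ 2 * (R * z ^ 2 * b) := by positivity
    have i4 : R * r * b ^ 3 ≤ R * r ^ 2 * b ^ 3 := by
      have : r ≤ r ^ 2 := by nlinarith
      gcongr
    have i5 : R * r ^ 2 * e ^ 3 ≤ R * r ^ 3 * e ^ 3 := by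
      have : r ^ 2 ≤ r ^ 3 := by nlinarith [sq_nonneg r]
      gcongr
    linarith
  have hi := intervalIntegral.integral_mono_on (μ := volume) hT
    (Continuous.intervalIntegrable (by fun_prop) _ _)
    (Continuous.intervalIntegrable (by fun_prop) _ _) (fun s _ => hp s)
  have ii : ∀ {f : ℝ → ℝ}, Continuous f → IntervalIntegrable f volume 0 T :=
    fun hf => hf.intervalIntegrable _ _
  rw [intervalIntegral.integral_add (ii (by fun_prop)) (ii (by fun_prop)),
    intervalIntegral.integral_add (ii (by fun_prop)) (ii (by fun_prop)),
    intervalIntegral.integral_add (ii (by fun_prop)) (ii (by fun_prop)),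
    intervalIntegral.integral_add (ii (by fun_prop)) (ii (by fun_prop))] at hi
  simp only [intervalIntegral.integral_const_mul] at hi
  rw [h1] at hi
  have f1 := hF (n + 1)
  have f2 := hF (n + 2)
  simp only [flux, cubeIntegral, Nat.add_assoc, Nat.reduceAdd] at *
  have g1 := mul_le_mul_of_nonneg_left f1 (by positivity : 0 ≤ 4 * r ^ 2 * (r ^ 2 + r ^ 3))
  have g2 := mul_le_mul_of_nonneg_left f2 (by positivity : 0 ≤ r ^ 2)
  have g3 := mul_le_mul_of_nonneg_left h2 (by positivity : 0 ≤ 4 * r ^ 2)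
  have g4 : r ^ 2 * M ≤ 4 * r ^ 2 * (r * M) := by
    have : 0 ≤ r ^ 2 * M := by positivity
    nlinarith
  linarith

theorem exists_cubeIntegral_bound (h : IsTailSolution r T x v) (hr : 1 ≤ r) (hT : 0 ≤ T)
    {B : ℝ} (hB : ∀ n, ∑ j ∈ Finset.range n, x j ^ 2 ≤ B) :
    ∃ C : ℝ, ∀ j, cubeIntegral r T v (j + 1) ≤ C := by
  have hr0 : 0 ≤ r := by linarith
  obtain ⟨M, hM, hF, hv⟩ := h.exists_energy_bound hr0 hT hB
  have hc := h.continuous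
  refine ⟨_, le_of_forall_two_step_bound (K := r * (M ^ 3 * T)) hr
    (by positivity : 0 ≤ M ^ 2 + (r ^ 2 + r ^ 3) * M + r * M) (fun n => ?_)
    (h.cubeIntegral_le_of_bound hr hT hM hF hv)⟩
  have : ∫ s in (0 : ℝ)..T, v (n + 1) s ^ 3 ≤ ∫ s in (0 : ℝ)..T, M ^ 3 :=
    intervalIntegral.integral_mono_on hT (Continuous.intervalIntegrable (by fun_prop) _ _)
      (by simp) fun s hs => pow_le_pow_left₀ (h.nonneg _ _) (hv n s hs) 3
  rw [intervalIntegral.integral_const, smul_eq_mul, sub_zero] at this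
  calc cubeIntegral r T v (n + 1) ≤ r ^ (n + 1) * (T * M ^ 3) :=
        mul_le_mul_of_nonneg_left this (by positivity)
    _ = _ := by ring

end IsTailSolution

/-! ### Contraction of the weighted distance and its equality case -/

/-- The squared norm of the weighted space in which the dyadic system is contracting. -/
noncomputable def weightedSq (x : ℕ → ℝ) : ℝ≥0∞ :=
  ∑' j, ENNReal.ofReal ((1 / 2) ^ j * x j ^ 2)

/-- The time integral over `[0, T]` of the dissipation of `(u j - v j) ^ 2`. -/
noncomputable def dissipation (r T : ℝ) (u v : ℕ → ℝ → ℝ) (j : ℕ) : ℝ :=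
  r ^ j * ∫ s in (0 : ℝ)..T, (u j s - v j s) ^ 2 * (u (j + 1) s + v (j + 1) s)

/-- The time integral over `[0, T]` of the exchange between the components `j` and `j + 1` of the
difference of two solutions. -/
noncomputable def exchange (r T : ℝ) (u v : ℕ → ℝ → ℝ) (j : ℕ) : ℝ :=
  r ^ j * ∫ s in (0 : ℝ)..T, (u j s ^ 2 - v j s ^ 2) * (u (j + 1) s - v (j + 1) s)

/-- Two solutions driven by the same noise: the difference of the components `0` is noise-free. -/
structure IsCoupledPair (r T : ℝ) (x y : ℕ → ℝ) (u v : ℕ → ℝ → ℝ) : Prop where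
  left : IsTailSolution r T x u
  right : IsTailSolution r T y v
  eq_zero : ∀ t ∈ Icc 0 T, u 0 t - v 0 t = x 0 - y 0 +
    ∫ s in (0 : ℝ)..t, -(u 0 s * u 1 s - v 0 s * v 1 s)

namespace IsCoupledPair

variable {r T : ℝ} {x y : ℕ → ℝ} {u v : ℕ → ℝ → ℝ}

theorem dissipation_nonneg (h : IsCoupledPair r T x y u v) (hr : 0 ≤ r) (hT : 0 ≤ T) (j : ℕ) :
    0 ≤ dissipation r T u v j :=
  mul_nonneg (pow_nonneg hr j) (intervalIntegral.integral_nonneg hT fun _ _ =>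
    mul_nonneg (sq_nonneg _) (add_nonneg (h.left.nonneg _ _) (h.right.nonneg _ _)))

theorem sq_sub_zero (h : IsCoupledPair r T x y u v) (hT : 0 ≤ T) :
    (u 0 T - v 0 T) ^ 2 = (x 0 - y 0) ^ 2 - dissipation r T u v 0 - exchange r T u v 0 := by
  have hu := h.left.continuous
  have hv := h.right.continuous
  have h0 : u 0 0 - v 0 0 = x 0 - y 0 := by simpa using h.eq_zero 0 ⟨le_rfl, hT⟩
  have hd : ∀ s ∈ Ioo 0 T, HasDerivAt (fun t => u 0 t - v 0 t)
      (-(u 0 s * u 1 s - v 0 s * v 1 s)) s := fun s hs =>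
    hasDerivAt_of_eqOn_integral (by fun_prop) h.eq_zero hs
  have h1 := integral_eq_sub_of_hasDerivAt_Ioo (f := fun s => (u 0 s - v 0 s) ^ 2)
    (g := fun s => 2 * (u 0 s - v 0 s) * -(u 0 s * u 1 s - v 0 s * v 1 s))
    (by fun_prop) (by fun_prop)
    (fun s hs => by simpa using (hd s hs).fun_pow 2) (right_mem_Icc.2 hT)
  have e : ∀ s, 2 * (u 0 s - v 0 s) * -(u 0 s * u 1 s - v 0 s * v 1 s)
      = -((u 0 s - v 0 s) ^ 2 * (u 1 s + v 1 s))
        - (u 0 s ^ 2 - v 0 s ^ 2) * (u 1 s - v 1 s) := fun s => by ring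
  simp only [e] at h1
  rw [intervalIntegral.integral_sub, intervalIntegral.integral_neg] at h1
  · rw [h0] at h1
    simp only [dissipation, exchange, pow_zero, zero_add]
    linarith
  all_goals exact Continuous.intervalIntegrable (by fun_prop) _ _

theorem sq_sub_succ (h : IsCoupledPair r T x y u v) (hT : 0 ≤ T) (j : ℕ) :
    (u (j + 1) T - v (j + 1) T) ^ 2 = (x (j + 1) - y (j + 1)) ^ 2
      - dissipation r T u v (j + 1) - exchange r T u v (j + 1) + 2 * exchange r T u v j := by
  have hu := h.left.continuous
  have hv := h.right.continuous
  have du := h.left.continuous_drift j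
  have dv := h.right.continuous_drift j
  have h1 := integral_eq_sub_of_hasDerivAt_Ioo (f := fun s => (u (j + 1) s - v (j + 1) s) ^ 2)
    (g := fun s => 2 * (u (j + 1) s - v (j + 1) s) * (drift r u j s - drift r v j s))
    (by fun_prop) (by fun_prop)
    (fun s hs => by simpa using
      ((h.left.hasDerivAt j hs).fun_sub (h.right.hasDerivAt j hs)).fun_pow 2) (right_mem_Icc.2 hT)
  have e : ∀ s, 2 * (u (j + 1) s - v (j + 1) s) * (drift r u j s - drift r v j s)
      = 2 * (r ^ j * ((u j s ^ 2 - v j s ^ 2) * (u (j + 1) s - v (j + 1) s)))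
        - r ^ (j + 1) * ((u (j + 1) s - v (j + 1) s) ^ 2 * (u (j + 2) s + v (j + 2) s))
        - r ^ (j + 1) *
          ((u (j + 1) s ^ 2 - v (j + 1) s ^ 2) * (u (j + 2) s - v (j + 2) s)) := fun s => by
    simp only [drift]; ring
  simp only [e] at h1
  rw [intervalIntegral.integral_sub, intervalIntegral.integral_sub] at h1
  · simp only [intervalIntegral.integral_const_mul] at h1
    rw [h.left.initial hT, h.right.initial hT] at h1
    simp only [dissipation, exchange, Nat.add_assoc, Nat.reduceAdd]
    linarith
  all_goals exact Continuous.intervalIntegrable (by fun_prop) _ _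

theorem weighted_balance (h : IsCoupledPair r T x y u v) (hT : 0 ≤ T) (n : ℕ) :
    ∑ j ∈ Finset.range (n + 1), (1 / 2) ^ j * (u j T - v j T) ^ 2
      + ∑ j ∈ Finset.range (n + 1), (1 / 2) ^ j * dissipation r T u v j
      = ∑ j ∈ Finset.range (n + 1), (1 / 2) ^ j * (x j - y j) ^ 2
        - (1 / 2) ^ n * exchange r T u v n := by
  induction n with
  | zero =>
    have := h.sq_sub_zero hT
    simp only [zero_add, Finset.sum_range_one, pow_zero]
    linarith
  | succ n ih =>
    rw [Finset.sum_range_succ, Finset.sum_range_succ (n := n + 1),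
      Finset.sum_range_succ (n := n + 1), h.sq_sub_succ hT]
    have : (1 / 2 : ℝ) ^ (n + 1) = (1 / 2) ^ n / 2 := by ring
    rw [this]
    linarith

/-- After expanding, the only terms of `-exchange` with a bad sign are `u_j² v_{j+1}` and `v_j²
u_{j+1}`, and `a²b ≤ a³ + b³` reduces both to cube integrals. Only this one-sided bound is needed.
-/
theorem exists_exchange_bound (h : IsCoupledPair r T x y u v) (hr : 1 ≤ r) (hT : 0 ≤ T)
    {B : ℝ} (hx : ∀ n, ∑ j ∈ Finset.range n, x j ^ 2 ≤ B)
    (hy : ∀ n, ∑ j ∈ Finset.range n, y j ^ 2 ≤ B) :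
    ∃ C, ∀ j, -exchange r T u v (j + 1) ≤ C := by
  obtain ⟨C, hC⟩ := h.left.exists_cubeIntegral_bound hr hT hx
  obtain ⟨C', hC'⟩ := h.right.exists_cubeIntegral_bound hr hT hy
  have cu := h.left.continuous
  have cv := h.right.continuous
  refine ⟨C + C' + (C + C'), fun j => ?_⟩
  have hp : ∀ s, -(r ^ (j + 1) *
      ((u (j + 1) s ^ 2 - v (j + 1) s ^ 2) * (u (j + 2) s - v (j + 2) s)))
      ≤ r ^ (j + 1) * u (j + 1) s ^ 3 + r ^ (j + 1) * v (j + 1) s ^ 3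
        + (r ^ (j + 2) * u (j + 2) s ^ 3 + r ^ (j + 2) * v (j + 2) s ^ 3) := by
    intro s
    have ha := h.left.nonneg j s
    have hb := h.right.nonneg j s
    have ha' : 0 ≤ u (j + 2) s := h.left.nonneg (j + 1) s
    have hb' : 0 ≤ v (j + 2) s := h.right.nonneg (j + 1) s
    have hR : r ^ (j + 1) ≤ r ^ (j + 2) := pow_le_pow_right₀ hr (by lia)
    have hR0 : 0 ≤ r ^ (j + 1) := by positivity
    have key : ∀ {a b : ℝ}, 0 ≤ a → 0 ≤ b → a ^ 2 * b ≤ a ^ 3 + b ^ 3 := by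
      intro a b ha hb
      rcases le_total a b with hab | hab
      · nlinarith [mul_le_mul_of_nonneg_right (pow_le_pow_left₀ ha hab 2) hb, pow_nonneg ha 3]
      · nlinarith [mul_le_mul_of_nonneg_left hab (sq_nonneg a), pow_nonneg hb 3]
    have k1 := key ha hb'
    have k2 := key hb ha'
    have c1 : r ^ (j + 1) * u (j + 2) s ^ 3 ≤ r ^ (j + 2) * u (j + 2) s ^ 3 := by gcongr
    have c2 : r ^ (j + 1) * v (j + 2) s ^ 3 ≤ r ^ (j + 2) * v (j + 2) s ^ 3 := by gcongr
    have p1 : 0 ≤ u (j + 1) s ^ 2 * u (j + 2) s := by positivity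
    have p2 : 0 ≤ v (j + 1) s ^ 2 * v (j + 2) s := by positivity
    have c3 := mul_le_mul_of_nonneg_left (show
      -((u (j + 1) s ^ 2 - v (j + 1) s ^ 2) * (u (j + 2) s - v (j + 2) s)) ≤
        u (j + 1) s ^ 3 + v (j + 1) s ^ 3 + (u (j + 2) s ^ 3 + v (j + 2) s ^ 3) by linarith) hR0
    linarith
  have hi := intervalIntegral.integral_mono_on (μ := volume) hT
    (Continuous.intervalIntegrable (by fun_prop) _ _)
    (Continuous.intervalIntegrable (by fun_prop) _ _) (fun s _ => hp s)
  have ii : ∀ {f : ℝ → ℝ}, Continuous f → IntervalIntegrable f volume 0 T :=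
    fun hf => hf.intervalIntegrable _ _
  rw [intervalIntegral.integral_neg, intervalIntegral.integral_add (ii (by fun_prop))
    (ii (by fun_prop)), intervalIntegral.integral_add (ii (by fun_prop)) (ii (by fun_prop)),
    intervalIntegral.integral_add (ii (by fun_prop)) (ii (by fun_prop))] at hi
  simp only [intervalIntegral.integral_const_mul] at hi
  have a1 := hC j
  have a2 := hC (j + 1)
  have b1 := hC' j
  have b2 := hC' (j + 1)
  simp only [exchange, cubeIntegral, Nat.add_assoc, Nat.reduceAdd] at *
  linarith

/-- The weighted distance of two solutions driven by the same noise does not increase, and the loss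
controls the dissipation of each component. -/
theorem weightedSq_add_dissipation_le (h : IsCoupledPair r T x y u v) (hr : 1 ≤ r) (hT : 0 ≤ T)
    {B : ℝ} (hx : ∀ n, ∑ j ∈ Finset.range n, x j ^ 2 ≤ B)
    (hy : ∀ n, ∑ j ∈ Finset.range n, y j ^ 2 ≤ B) (m : ℕ) :
    weightedSq (fun j => u j T - v j T) + ENNReal.ofReal ((1 / 2) ^ m * dissipation r T u v m)
      ≤ weightedSq (fun j => x j - y j) := by
  obtain ⟨C, hC⟩ := h.exists_exchange_bound hr hT hx hy
  have hD := h.dissipation_nonneg (by linarith) hT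
  -- The shift by `2` matches the balance at level `n + 1`: the exchange bound starts at index `1`,
  -- since component `0` is signed.
  have t1 := ((ENNReal.tendsto_nat_tsum fun j => ENNReal.ofReal ((1 / 2) ^ j * (u j T - v j T) ^ 2)
    ).comp (tendsto_add_atTop_nat 2)).add_const
      (ENNReal.ofReal ((1 / 2) ^ m * dissipation r T u v m))
  have t2 : Tendsto (fun n : ℕ => ENNReal.ofReal ((1 / 2 : ℝ) ^ (n + 1) * C)) atTop
      (𝓝 (ENNReal.ofReal (0 * C))) :=
    ENNReal.tendsto_ofReal (((tendsto_pow_atTop_nhds_zero_of_lt_one (by norm_num)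
      (by norm_num)).comp (tendsto_add_atTop_nat 1)).mul_const C)
  rw [zero_mul, ENNReal.ofReal_zero] at t2
  have t3 := ((ENNReal.tendsto_nat_tsum fun j => ENNReal.ofReal ((1 / 2) ^ j * (x j - y j) ^ 2)
    ).comp (tendsto_add_atTop_nat 2)).add t2
  rw [add_zero] at t3
  refine le_of_tendsto_of_tendsto t1 t3 ?_
  filter_upwards [eventually_ge_atTop m] with n hn
  have hb := h.weighted_balance hT (n + 1)
  have hs : (1 / 2) ^ m * dissipation r T u v m ≤
      ∑ j ∈ Finset.range (n + 1 + 1), (1 / 2) ^ j * dissipation r T u v j :=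
    Finset.single_le_sum (f := fun j => (1 / 2 : ℝ) ^ j * dissipation r T u v j)
      (fun j _ => mul_nonneg (by positivity) (hD j)) (Finset.mem_range.2 (by lia))
  have he := mul_le_mul_of_nonneg_left (hC n) (by positivity : (0 : ℝ) ≤ (1 / 2) ^ (n + 1))
  simp only [Function.comp_def]
  rw [← ENNReal.ofReal_sum_of_nonneg fun j _ => by positivity,
    ← ENNReal.ofReal_sum_of_nonneg fun j _ => by positivity,
    ← ENNReal.ofReal_add (Finset.sum_nonneg fun j _ => by positivity)
      (mul_nonneg (by positivity) (hD m))]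
  refine (ENNReal.ofReal_le_ofReal ?_).trans ENNReal.ofReal_add_le
  simp only [Nat.add_assoc, Nat.reduceAdd] at *
  linarith

theorem weightedSq_le (h : IsCoupledPair r T x y u v) (hr : 1 ≤ r) (hT : 0 ≤ T)
    {B : ℝ} (hx : ∀ n, ∑ j ∈ Finset.range n, x j ^ 2 ≤ B)
    (hy : ∀ n, ∑ j ∈ Finset.range n, y j ^ 2 ≤ B) :
    weightedSq (fun j => u j T - v j T) ≤ weightedSq (fun j => x j - y j) :=
  le_self_add.trans (h.weightedSq_add_dissipation_le hr hT hx hy 0)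

/-- If no dissipation occurs, then the two solutions coincide. -/
theorem eqOn_of_weightedSq_eq (h : IsCoupledPair r T x y u v) (hr : 1 ≤ r) (hT : 0 < T)
    {B : ℝ} (hx : ∀ n, ∑ j ∈ Finset.range n, x j ^ 2 ≤ B)
    (hy : ∀ n, ∑ j ∈ Finset.range n, y j ^ 2 ≤ B)
    (hfin : weightedSq (fun j => x j - y j) ≠ ∞)
    (heq : weightedSq (fun j => u j T - v j T) = weightedSq (fun j => x j - y j)) (j : ℕ) :
    EqOn (u j) (v j) (Icc 0 T) := by
  have cu := h.left.continuous
  have cv := h.right.continuous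
  have hr0 : 0 < r := by linarith
  have hd : dissipation r T u v j ≤ 0 := by
    have h1 := h.weightedSq_add_dissipation_le hr hT.le hx hy j
    rw [heq] at h1
    have h2 : ENNReal.ofReal ((1 / 2) ^ j * dissipation r T u v j) ≤ 0 := by
      refine (ENNReal.add_le_add_iff_left hfin).1 ?_
      rwa [add_zero]
    have h3 := ENNReal.ofReal_eq_zero.1 (le_antisymm h2 zero_le)
    exact nonpos_of_mul_nonpos_right h3 (by positivity)
  have hz : ∀ s ∈ Icc 0 T, (u j s - v j s) ^ 2 * (u (j + 1) s + v (j + 1) s) = 0 := by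
    intro s hs
    by_contra hne
    have hnn : ∀ s, 0 ≤ (u j s - v j s) ^ 2 * (u (j + 1) s + v (j + 1) s) := fun s =>
      mul_nonneg (sq_nonneg _) (add_nonneg (h.left.nonneg _ _) (h.right.nonneg _ _))
    have := intervalIntegral.integral_pos hT
      (f := fun s => (u j s - v j s) ^ 2 * (u (j + 1) s + v (j + 1) s))
      (Continuous.continuousOn (by fun_prop)) (fun s _ => hnn s)
      ⟨s, hs, (hnn s).lt_of_ne' hne⟩
    have : 0 < dissipation r T u v j := mul_pos (pow_pos hr0 j) this
    linarith
  -- Where the second factor vanishes, `u_{j+1} = v_{j+1} = 0`. A nonnegative component that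
  -- vanishes at an interior time has a minimum there, so its drift, reduced to `r^j w_j²`, is zero.
  have key : ∀ {z : ℕ → ℝ} {w : ℕ → ℝ → ℝ}, IsTailSolution r T z w → ∀ s ∈ Ioo 0 T,
      w (j + 1) s = 0 → w j s = 0 := by
    intro z w hw s hs h0
    have hm : IsLocalMin (w (j + 1)) s :=
      Eventually.of_forall fun t => by rw [h0]; exact hw.nonneg j t
    have h1 := hm.hasDerivAt_eq_zero (hw.hasDerivAt j hs)
    simp only [drift, h0, mul_zero, zero_mul, neg_zero, zero_add] at h1
    exact pow_eq_zero_iff two_ne_zero |>.1 ((mul_eq_zero.1 h1).resolve_left (by positivity))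
  have hI : EqOn (u j) (v j) (Ioo 0 T) := by
    intro s hs
    rcases mul_eq_zero.1 (hz s (Ioo_subset_Icc_self hs)) with h0 | h0
    · exact sub_eq_zero.1 (pow_eq_zero_iff two_ne_zero |>.1 h0)
    · have hu := h.left.nonneg j s
      have hv := h.right.nonneg j s
      rw [key h.left s hs (by linarith), key h.right s hs (by linarith)]
  rw [← closure_Ioo hT.ne]
  exact hI.closure (cu j) (cv j)

end IsCoupledPair

/-! ### Existence of optimal couplings -/

open scoped BoundedContinuousFunction

section Coupling

variable {X Y : Type*} [TopologicalSpace X] [PolishSpace X] [MeasurableSpace X] [BorelSpace X]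
  [TopologicalSpace Y] [PolishSpace Y] [MeasurableSpace Y] [BorelSpace Y]

theorem isTightMeasureSet_couplings (μ : Measure X) (ν : Measure Y) [IsProbabilityMeasure μ]
    [IsProbabilityMeasure ν] :
    IsTightMeasureSet {γ : Measure (X × Y) | γ.map Prod.fst = μ ∧ γ.map Prod.snd = ν} := by
  rw [isTightMeasureSet_iff_exists_isCompact_measure_compl_le]
  intro ε hε
  have hμ := isTightMeasureSet_iff_exists_isCompact_measure_compl_le.1
    (isTightMeasureSet_singleton (μ := μ)) (ε / 2) (ENNReal.half_pos hε.ne')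
  have hν := isTightMeasureSet_iff_exists_isCompact_measure_compl_le.1
    (isTightMeasureSet_singleton (μ := ν)) (ε / 2) (ENNReal.half_pos hε.ne')
  obtain ⟨K, hK, hKμ⟩ := hμ
  obtain ⟨L, hL, hLν⟩ := hν
  refine ⟨K ×ˢ L, hK.prod hL, ?_⟩
  rintro γ ⟨h1, h2⟩
  have e : (K ×ˢ L)ᶜ = Prod.fst ⁻¹' Kᶜ ∪ Prod.snd ⁻¹' Lᶜ := by
    ext ⟨a, b⟩
    simp only [mem_compl_iff, mem_prod, mem_union, mem_preimage]
    tauto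
  calc γ (K ×ˢ L)ᶜ ≤ γ (Prod.fst ⁻¹' Kᶜ) + γ (Prod.snd ⁻¹' Lᶜ) := by
        rw [e]; exact measure_union_le _ _
    _ = μ Kᶜ + ν Lᶜ := by
        rw [← Measure.map_apply measurable_fst hK.measurableSet.compl,
          ← Measure.map_apply measurable_snd hL.measurableSet.compl, h1, h2]
    _ ≤ ε / 2 + ε / 2 := add_le_add (hKμ μ rfl) (hLν ν rfl)
    _ = ε := ENNReal.add_halves ε

/-- By monotone convergence the functional is a supremum of integrals of bounded continuous
functions, each weakly continuous. -/
theorem lowerSemicontinuous_lintegral_iSup {Z : Type*} [TopologicalSpace Z] [MeasurableSpace Z]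
    [OpensMeasurableSpace Z] {f : ℕ → Z →ᵇ ℝ≥0} (hf : ∀ z, Monotone fun n => f n z) :
    LowerSemicontinuous fun γ : ProbabilityMeasure Z =>
      ∫⁻ z, ⨆ n, (f n z : ℝ≥0∞) ∂(γ : Measure Z) := by
  have e : (fun γ : ProbabilityMeasure Z => ∫⁻ z, ⨆ n, (f n z : ℝ≥0∞) ∂(γ : Measure Z)) =
      fun γ : ProbabilityMeasure Z => ⨆ n, ∫⁻ z, (f n z : ℝ≥0∞) ∂(γ : Measure Z) := by
    funext γ
    exact lintegral_iSup (fun n => (f n).measurable_coe_ennreal_comp)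
      fun m n hmn z => ENNReal.coe_le_coe.2 (hf z hmn)
  rw [e]
  refine lowerSemicontinuous_iSup fun n => Continuous.lowerSemicontinuous ?_
  rw [continuous_iff_continuousAt]
  exact fun γ => (ProbabilityMeasure.tendsto_iff_forall_lintegral_tendsto.1 tendsto_id) (f n)

/-- Existence of an optimal coupling, for a cost which is an increasing limit of bounded continuous
functions. -/
theorem exists_optimal_coupling (μ : Measure X) (ν : Measure Y) [IsProbabilityMeasure μ]
    [IsProbabilityMeasure ν] {f : ℕ → X × Y →ᵇ ℝ≥0} (hf : ∀ z, Monotone fun n => f n z) :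
    ∃ γ : Measure (X × Y), IsProbabilityMeasure γ ∧ γ.map Prod.fst = μ ∧ γ.map Prod.snd = ν ∧
      ∀ γ' : Measure (X × Y), γ'.map Prod.fst = μ → γ'.map Prod.snd = ν →
        ∫⁻ z, ⨆ n, (f n z : ℝ≥0∞) ∂γ ≤ ∫⁻ z, ⨆ n, (f n z : ℝ≥0∞) ∂γ' := by
  let := TopologicalSpace.upgradeIsCompletelyMetrizable X
  let := TopologicalSpace.upgradeIsCompletelyMetrizable Y
  let S : Set (ProbabilityMeasure (X × Y)) :=
    {γ | (γ : Measure (X × Y)).map Prod.fst = μ ∧ (γ : Measure (X × Y)).map Prod.snd = ν}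
  have hS : IsClosed S := by
    have h1 : S = {γ | γ.map continuous_fst.measurable.aemeasurable = ⟨μ, inferInstance⟩} ∩
        {γ | γ.map continuous_snd.measurable.aemeasurable = ⟨ν, inferInstance⟩} := by
      ext γ
      rw [mem_inter_iff, mem_ofPred_eq, mem_ofPred_eq, mem_ofPred_eq]
      exact ⟨fun h => ⟨Subtype.ext h.1, Subtype.ext h.2⟩,
        fun h => ⟨congrArg Subtype.val h.1, congrArg Subtype.val h.2⟩⟩
    rw [h1]
    exact (isClosed_eq (ProbabilityMeasure.continuous_map continuous_fst) continuous_const).inter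
      (isClosed_eq (ProbabilityMeasure.continuous_map continuous_snd) continuous_const)
  -- Prokhorov's theorem: the couplings are tight because their marginals are fixed.
  have hc : IsCompact S := by
    rw [← hS.closure_eq]
    refine isCompact_closure_of_isTightMeasureSet ((isTightMeasureSet_couplings μ ν).subset ?_)
    rintro _ ⟨γ, hγ, rfl⟩
    exact hγ
  have hne : S.Nonempty :=
    ⟨⟨μ.prod ν, inferInstance⟩, Measure.fst_prod, Measure.snd_prod⟩
  obtain ⟨γ, hγ, hmin⟩ := LowerSemicontinuousOn.exists_isMinOn hne hc
    ((lowerSemicontinuous_lintegral_iSup hf).lowerSemicontinuousOn S)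
  refine ⟨γ, inferInstance, hγ.1, hγ.2, fun γ' h1 h2 => ?_⟩
  have : IsProbabilityMeasure γ' :=
    ⟨by rw [← preimage_univ (f := Prod.fst), ← Measure.map_apply measurable_fst .univ, h1,
      measure_univ]⟩
  exact hmin (show (⟨γ', this⟩ : ProbabilityMeasure (X × Y)) ∈ S from ⟨h1, h2⟩)

end Coupling

/-! ### The weighted distance as a transport cost -/

theorem measurable_weightedSq : Measurable weightedSq :=
  Measurable.tsum fun j =>
    (((measurable_pi_apply j).pow_const 2).const_mul _).ennreal_ofReal

/-- Bounded continuous approximations of the weighted squared distance. -/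
noncomputable def weightedSqApprox (n : ℕ) : (ℕ → ℝ) × (ℕ → ℝ) →ᵇ ℝ≥0 :=
  BoundedContinuousFunction.mkOfBound
    ⟨fun p => min n (∑ j ∈ Finset.range n, ((1 / 2) ^ j * (p.1 j - p.2 j) ^ 2).toNNReal),
      by fun_prop⟩ n fun p q => by
    change |((min (n : ℝ≥0) _ : ℝ≥0) : ℝ) - ((min (n : ℝ≥0) _ : ℝ≥0) : ℝ)| ≤ n
    rw [abs_le]
    generalize ∑ j ∈ Finset.range n, ((1 / 2) ^ j * (p.1 j - p.2 j) ^ 2).toNNReal = a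
    generalize ∑ j ∈ Finset.range n, ((1 / 2) ^ j * (q.1 j - q.2 j) ^ 2).toNNReal = b
    have h1 : ((min (n : ℝ≥0) a : ℝ≥0) : ℝ) ≤ n := mod_cast min_le_left _ _
    have h2 : ((min (n : ℝ≥0) b : ℝ≥0) : ℝ) ≤ n := mod_cast min_le_left _ _
    have h3 := (min (n : ℝ≥0) a).coe_nonneg
    have h4 := (min (n : ℝ≥0) b).coe_nonneg
    exact ⟨by linarith, by linarith⟩

theorem monotone_weightedSqApprox (p : (ℕ → ℝ) × (ℕ → ℝ)) :
    Monotone fun n => weightedSqApprox n p := fun m n hmn =>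
  min_le_min (by exact_mod_cast hmn)
    (Finset.sum_le_sum_of_subset (Finset.range_subset_range.2 hmn))

theorem iSup_weightedSqApprox (p : (ℕ → ℝ) × (ℕ → ℝ)) :
    ⨆ n, (weightedSqApprox n p : ℝ≥0∞) = weightedSq (fun j => p.1 j - p.2 j) := by
  have h1 : Tendsto (fun n => (weightedSqApprox n p : ℝ≥0∞)) atTop
      (𝓝 (min ∞ (weightedSq fun j => p.1 j - p.2 j))) := by
    have e : ∀ n, (weightedSqApprox n p : ℝ≥0∞) = min (n : ℝ≥0∞)
        (∑ j ∈ Finset.range n, ENNReal.ofReal ((1 / 2) ^ j * (p.1 j - p.2 j) ^ 2)) := fun n => by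
      change ((min (n : ℝ≥0) _ : ℝ≥0) : ℝ≥0∞) = _
      rw [ENNReal.coe_min, ENNReal.ofNNReal_finsetSum]
      rfl
    simp only [e]
    exact ENNReal.tendsto_nat_nhds_top.min (ENNReal.tendsto_nat_tsum _)
  rw [min_eq_right le_top] at h1
  exact tendsto_nhds_unique (tendsto_atTop_iSup fun m n hmn =>
    ENNReal.coe_le_coe.2 (monotone_weightedSqApprox p hmn)) h1

theorem exists_coupling_minimizing_weightedSq (μ ν : Measure (ℕ → ℝ)) [IsProbabilityMeasure μ]
    [IsProbabilityMeasure ν] :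
    ∃ γ : Measure ((ℕ → ℝ) × (ℕ → ℝ)), IsProbabilityMeasure γ ∧ γ.map Prod.fst = μ ∧
      γ.map Prod.snd = ν ∧ ∀ γ' : Measure ((ℕ → ℝ) × (ℕ → ℝ)), γ'.map Prod.fst = μ →
        γ'.map Prod.snd = ν → ∫⁻ p, weightedSq (fun j => p.1 j - p.2 j) ∂γ ≤
          ∫⁻ p, weightedSq (fun j => p.1 j - p.2 j) ∂γ' := by
  simpa only [iSup_weightedSqApprox] using
    exists_optimal_coupling μ ν monotone_weightedSqApprox

theorem weightedSq_sub_le (x y : ℕ → ℝ) :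
    weightedSq (fun j => x j - y j) ≤ 2 * weightedSq x + 2 * weightedSq y := by
  simp only [weightedSq]
  rw [← ENNReal.tsum_mul_left, ← ENNReal.tsum_mul_left, ← ENNReal.tsum_add]
  refine ENNReal.tsum_le_tsum fun j => ?_
  rw [show (2 : ℝ≥0∞) = ENNReal.ofReal 2 by simp, ← ENNReal.ofReal_mul zero_le_two,
    ← ENNReal.ofReal_mul zero_le_two, ← ENNReal.ofReal_add (by positivity) (by positivity)]
  refine ENNReal.ofReal_le_ofReal ?_
  have : (0 : ℝ) ≤ (1 / 2) ^ j := by positivity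
  nlinarith [mul_nonneg this (sq_nonneg (x j + y j))]

/-! ### Gluing two solutions along a common noise -/

theorem exists_gluing {X₁ X₂ W Y₁ Y₂ : Type*} [MeasurableSpace X₁] [MeasurableSpace X₂]
    [MeasurableSpace W] [MeasurableSpace Y₁] [StandardBorelSpace Y₁] [Nonempty Y₁]
    [MeasurableSpace Y₂] [StandardBorelSpace Y₂] [Nonempty Y₂]
    (γ : Measure (X₁ × X₂)) [IsProbabilityMeasure γ] (κ : Measure W) [IsProbabilityMeasure κ]
    (ρ₁ : Measure ((X₁ × W) × Y₁)) [IsProbabilityMeasure ρ₁]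
    (ρ₂ : Measure ((X₂ × W) × Y₂)) [IsProbabilityMeasure ρ₂]
    (h₁ : ρ₁.map Prod.fst = (γ.map Prod.fst).prod κ)
    (h₂ : ρ₂.map Prod.fst = (γ.map Prod.snd).prod κ) :
    ∃ Γ : Measure (((X₁ × X₂) × W) × (Y₁ × Y₂)), IsProbabilityMeasure Γ ∧
      Γ.map (fun p => p.1.1) = γ ∧
      Γ.map (fun p => ((p.1.1.1, p.1.2), p.2.1)) = ρ₁ ∧
      Γ.map (fun p => ((p.1.1.2, p.1.2), p.2.2)) = ρ₂ := by
  have m₁ : Measurable fun p : (X₁ × X₂) × W => (p.1.1, p.2) := by fun_prop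
  have m₂ : Measurable fun p : (X₁ × X₂) × W => (p.1.2, p.2) := by fun_prop
  let K₁ : Kernel ((X₁ × X₂) × W) Y₁ := ρ₁.condKernel.comap _ m₁
  let K₂ : Kernel ((X₁ × X₂) × W) Y₂ := ρ₂.condKernel.comap _ m₂
  have e₁ : (γ.prod κ).map (fun p => (p.1.1, p.2)) = ρ₁.fst := by
    rw [Measure.fst, h₁]
    have := Measure.map_prod_map γ κ measurable_fst measurable_id
    rw [Measure.map_id] at this
    exact this.symm
  have e₂ : (γ.prod κ).map (fun p => (p.1.2, p.2)) = ρ₂.fst := by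
    rw [Measure.fst, h₂]
    have := Measure.map_prod_map γ κ measurable_snd measurable_id
    rw [Measure.map_id] at this
    exact this.symm
  -- The noise is drawn independently of the initial pair; given both, the two paths are drawn
  -- independently from their own conditional laws.
  refine ⟨(γ.prod κ) ⊗ₘ (K₁ ×ₖ K₂), inferInstance, ?_, ?_, ?_⟩
  · have : (fun p : ((X₁ × X₂) × W) × (Y₁ × Y₂) => p.1.1) = Prod.fst ∘ Prod.fst := rfl
    rw [this, ← Measure.map_map measurable_fst measurable_fst]
    have h : ((γ.prod κ) ⊗ₘ (K₁ ×ₖ K₂)).map Prod.fst = γ.prod κ := Measure.fst_compProd _ _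
    rw [h]
    exact Measure.fst_prod
  · refine Measure.ext_of_lintegral _ fun f hf => ?_
    rw [lintegral_map hf (by fun_prop), Measure.lintegral_compProd (by fun_prop)]
    conv_rhs => rw [← ρ₁.disintegrate ρ₁.condKernel, Measure.lintegral_compProd hf, ← e₁,
      lintegral_map (by fun_prop) m₁]
    refine lintegral_congr fun p => ?_
    rw [Kernel.lintegral_prod _ _ _ (by fun_prop)]
    simp [K₁, K₂]
  · refine Measure.ext_of_lintegral _ fun f hf => ?_
    rw [lintegral_map hf (by fun_prop), Measure.lintegral_compProd (by fun_prop)]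
    conv_rhs => rw [← ρ₂.disintegrate ρ₂.condKernel, Measure.lintegral_compProd hf, ← e₂,
      lintegral_map (by fun_prop) m₂]
    refine lintegral_congr fun p => ?_
    rw [Kernel.lintegral_prod _ _ _ (by fun_prop)]
    simp [K₁, K₂]

/-! ### Path space and the set of solutions -/

/-- The space of real continuous paths carries its Borel σ-algebra. -/
instance instMeasurableSpacePath (T : ℝ) : MeasurableSpace C(Icc 0 T, ℝ) := borel _

instance instBorelSpacePath (T : ℝ) : BorelSpace C(Icc 0 T, ℝ) := ⟨rfl⟩

/-- The paths of the components, extended to the real line by constants. -/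
noncomputable def extendPath {T : ℝ} (hT : 0 ≤ T) (v : ℕ → C(Icc 0 T, ℝ)) (j : ℕ) (t : ℝ) : ℝ :=
  v j (projIcc 0 T hT t)

theorem continuous_extendPath_uncurry {T : ℝ} (hT : 0 ≤ T) (j : ℕ) :
    Continuous fun p : (ℕ → C(Icc 0 T, ℝ)) × ℝ => extendPath hT p.1 j p.2 := by
  have := continuous_projIcc (h := hT)
  unfold extendPath
  fun_prop

theorem continuous_extendPath {T : ℝ} (hT : 0 ≤ T) (v : ℕ → C(Icc 0 T, ℝ)) (j : ℕ) :
    Continuous (extendPath hT v j) :=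
  (continuous_extendPath_uncurry hT j).comp (Continuous.prodMk_right v)

theorem extendPath_of_mem {T : ℝ} (hT : 0 ≤ T) (v : ℕ → C(Icc 0 T, ℝ)) (j : ℕ) {t : ℝ}
    (ht : t ∈ Icc 0 T) : extendPath hT v j t = v j ⟨t, ht⟩ := by
  rw [extendPath, projIcc_of_mem hT ht]

/-- The triples `((x, w), v)` such that the path `v` solves the dyadic system with initial condition
`x` and with a noise that takes the values `w n` at the times `q n`. -/
def solutionSet (r σ : ℝ) {T : ℝ} (hT : 0 ≤ T) (q : ℕ → ℝ) :
    Set (((ℕ → ℝ) × (ℕ → ℝ)) × (ℕ → C(Icc 0 T, ℝ))) :=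
  {p | (∃ B : ℕ, ∀ n, ∑ j ∈ Finset.range n, p.1.1 j ^ 2 ≤ (B : ℝ)) ∧
    (∀ n, extendPath hT p.2 0 (q n) = p.1.1 0 +
      (∫ s in (0 : ℝ)..q n, -(extendPath hT p.2 0 s * extendPath hT p.2 1 s)) + σ * p.1.2 n) ∧
    IsTailSolution r T p.1.1 (extendPath hT p.2)}

theorem measurableSet_solutionSet (r σ : ℝ) {T : ℝ} (hT : 0 ≤ T) (q : ℕ → ℝ) :
    MeasurableSet (solutionSet r σ hT q) := by
  have he := continuous_extendPath_uncurry hT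
  have hc : ∀ j t, Continuous fun p : ((ℕ → ℝ) × (ℕ → ℝ)) × (ℕ → C(Icc 0 T, ℝ)) =>
      extendPath hT p.2 j t := fun j t => (he j).comp (by fun_prop : Continuous fun
        p : ((ℕ → ℝ) × (ℕ → ℝ)) × (ℕ → C(Icc 0 T, ℝ)) => (p.2, t))
  have hc' : ∀ j, Continuous fun p : (((ℕ → ℝ) × (ℕ → ℝ)) × (ℕ → C(Icc 0 T, ℝ))) × ℝ =>
      extendPath hT p.1.2 j p.2 := fun j => (he j).comp (by fun_prop : Continuous fun
        p : (((ℕ → ℝ) × (ℕ → ℝ)) × (ℕ → C(Icc 0 T, ℝ))) × ℝ => (p.1.2, p.2))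
  have h1 : MeasurableSet {p : ((ℕ → ℝ) × (ℕ → ℝ)) × (ℕ → C(Icc 0 T, ℝ)) |
      ∃ B : ℕ, ∀ n, ∑ j ∈ Finset.range n, p.1.1 j ^ 2 ≤ (B : ℝ)} := by
    have : {p : ((ℕ → ℝ) × (ℕ → ℝ)) × (ℕ → C(Icc 0 T, ℝ)) |
        ∃ B : ℕ, ∀ n, ∑ j ∈ Finset.range n, p.1.1 j ^ 2 ≤ (B : ℝ)}
        = ⋃ B : ℕ, ⋂ n, {p | ∑ j ∈ Finset.range n, p.1.1 j ^ 2 ≤ (B : ℝ)} := by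
      ext p; simp
    rw [this]
    exact .iUnion fun B => .iInter fun n => (isClosed_le (by fun_prop) (by fun_prop)).measurableSet
  have h2 : IsClosed {p : ((ℕ → ℝ) × (ℕ → ℝ)) × (ℕ → C(Icc 0 T, ℝ)) |
      ∀ n, extendPath hT p.2 0 (q n) = p.1.1 0 +
      (∫ s in (0 : ℝ)..q n, -(extendPath hT p.2 0 s * extendPath hT p.2 1 s)) + σ * p.1.2 n} := by
    rw [ofPred_forall]
    refine isClosed_iInter fun n => isClosed_eq (hc _ _) (.add (.add (by fun_prop) ?_) (by fun_prop))
    exact intervalIntegral.continuous_parametric_intervalIntegral_of_continuous'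
      (((hc' 0).mul (hc' 1)).neg) _ _
  have h3 : IsClosed {p : ((ℕ → ℝ) × (ℕ → ℝ)) × (ℕ → C(Icc 0 T, ℝ)) |
      ∀ j t, 0 ≤ extendPath hT p.2 (j + 1) t} := by
    simp only [ofPred_forall]
    exact isClosed_iInter fun j => isClosed_iInter fun t => isClosed_le continuous_const (hc _ _)
  have h4 : IsClosed {p : ((ℕ → ℝ) × (ℕ → ℝ)) × (ℕ → C(Icc 0 T, ℝ)) |
      ∀ j, ∀ t ∈ Icc 0 T, extendPath hT p.2 (j + 1) t = p.1.1 (j + 1) +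
        ∫ s in (0 : ℝ)..t, drift r (extendPath hT p.2) j s} := by
    simp only [ofPred_forall]
    refine isClosed_iInter fun j => isClosed_iInter fun t => isClosed_iInter fun _ =>
      isClosed_eq (hc _ _) (.add (by fun_prop) ?_)
    refine intervalIntegral.continuous_parametric_intervalIntegral_of_continuous' ?_ _ _
    simp only [Function.uncurry_def, drift]
    have a := hc' j
    have b := hc' (j + 1)
    have c := hc' (j + 2)
    fun_prop
  convert h1.inter (h2.measurableSet.inter (h3.measurableSet.inter h4.measurableSet)) using 1
  ext p
  exact and_congr_right fun _ => and_congr_right fun _ =>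
    ⟨fun h => And.intro h.nonneg h.eq_succ, fun h => ⟨continuous_extendPath hT _, h.1, h.2⟩⟩

/-- Subtracting the two equations cancels the noise at the times `q n`. Both sides of the resulting
identity are continuous, so it extends to `[0, T]`; this is why countably many noise values are
enough. -/
theorem isCoupledPair_of_mem_solutionSet {r σ T : ℝ} {hT : 0 ≤ T} {q : ℕ → ℝ}
    (hq : Icc 0 T ⊆ closure (range q)) {x y w : ℕ → ℝ} {u v : ℕ → C(Icc 0 T, ℝ)}
    (hu : ((x, w), u) ∈ solutionSet r σ hT q) (hv : ((y, w), v) ∈ solutionSet r σ hT q) :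
    IsCoupledPair r T x y (extendPath hT u) (extendPath hT v) := by
  obtain ⟨-, hu0, hu⟩ := hu
  obtain ⟨-, hv0, hv⟩ := hv
  refine ⟨hu, hv, ?_⟩
  have cu := continuous_extendPath hT u
  have cv := continuous_extendPath hT v
  have hc : Continuous fun s => -(extendPath hT u 0 s * extendPath hT u 1 s -
      extendPath hT v 0 s * extendPath hT v 1 s) := by fun_prop
  have hi : Continuous fun t => ∫ s in (0 : ℝ)..t, -(extendPath hT u 0 s * extendPath hT u 1 s -
      extendPath hT v 0 s * extendPath hT v 1 s) :=
    intervalIntegral.continuous_primitive (fun a b => hc.intervalIntegrable a b) 0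
  have key : EqOn (fun t => extendPath hT u 0 t - extendPath hT v 0 t) (fun t => x 0 - y 0 +
      ∫ s in (0 : ℝ)..t, -(extendPath hT u 0 s * extendPath hT u 1 s -
        extendPath hT v 0 s * extendPath hT v 1 s)) (range q) := by
    rintro _ ⟨n, rfl⟩
    have a := hu0 n
    have b := hv0 n
    have e : ∀ s, -(extendPath hT u 0 s * extendPath hT u 1 s -
      extendPath hT v 0 s * extendPath hT v 1 s) = -(extendPath hT u 0 s * extendPath hT u 1 s) -
      -(extendPath hT v 0 s * extendPath hT v 1 s) := fun s => by ring
    simp only [e]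
    rw [intervalIntegral.integral_sub]
    · simp only at a b
      linarith
    all_goals exact Continuous.intervalIntegrable (by fun_prop) _ _
  exact fun t ht => key.closure (by fun_prop) (by fun_prop) (hq ht)

/-! ### Rigidity of stationary laws -/

/-- Two stationary laws of a random dynamical system with the same noise law coincide, if every two
trajectories with the same noise do not move apart, and coincide when their distance is constant. -/
theorem map_snd_eq_of_contracting {W Y : Type*} [MeasurableSpace W] [MeasurableSpace Y]
    [StandardBorelSpace Y] {G : Set (((ℕ → ℝ) × W) × Y)} {e : Y → ℕ → ℝ} (he : Measurable e)
    (hG : ∀ {x y w u v}, ((x, w), u) ∈ G → ((y, w), v) ∈ G →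
      weightedSq (fun j => e u j - e v j) ≤ weightedSq (fun j => x j - y j))
    (hGeq : ∀ {x y w u v}, ((x, w), u) ∈ G → ((y, w), v) ∈ G →
      weightedSq (fun j => x j - y j) ≠ ∞ →
      weightedSq (fun j => e u j - e v j) = weightedSq (fun j => x j - y j) → u = v)
    {μ₁ μ₂ : Measure (ℕ → ℝ)} {κ : Measure W} [IsProbabilityMeasure μ₁]
    [IsProbabilityMeasure μ₂] [IsProbabilityMeasure κ]
    {ρ₁ ρ₂ : Measure (((ℕ → ℝ) × W) × Y)} [IsProbabilityMeasure ρ₁]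
    [IsProbabilityMeasure ρ₂] (hρ₁ : ∀ᵐ p ∂ρ₁, p ∈ G) (hρ₂ : ∀ᵐ p ∂ρ₂, p ∈ G)
    (hf₁ : ρ₁.map Prod.fst = μ₁.prod κ) (hf₂ : ρ₂.map Prod.fst = μ₂.prod κ)
    (hs₁ : ρ₁.map (fun p => e p.2) = μ₁) (hs₂ : ρ₂.map (fun p => e p.2) = μ₂)
    (hm₁ : ∫⁻ x, weightedSq x ∂μ₁ ≠ ∞) (hm₂ : ∫⁻ x, weightedSq x ∂μ₂ ≠ ∞) :
    ρ₁.map Prod.snd = ρ₂.map Prod.snd := by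
  have : Nonempty Y := (nonempty_of_isProbabilityMeasure ρ₁).map Prod.snd
  obtain ⟨γ, hγ, hγ₁, hγ₂, hmin⟩ := exists_coupling_minimizing_weightedSq μ₁ μ₂
  obtain ⟨Γ, hΓ, hΓγ, hΓ₁, hΓ₂⟩ := exists_gluing γ κ ρ₁ ρ₂ (by rw [hf₁, hγ₁]) (by rw [hf₂, hγ₂])
  have hw := measurable_weightedSq
  have m₁ : Measurable fun p : (((ℕ → ℝ) × (ℕ → ℝ)) × W) × (Y × Y) =>
    ((p.1.1.1, p.1.2), p.2.1) := by fun_prop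
  have m₂ : Measurable fun p : (((ℕ → ℝ) × (ℕ → ℝ)) × W) × (Y × Y) =>
    ((p.1.1.2, p.1.2), p.2.2) := by fun_prop
  rw [← hΓ₁] at hρ₁ hs₁
  rw [← hΓ₂] at hρ₂ hs₂
  replace hρ₁ := ae_of_ae_map m₁.aemeasurable hρ₁
  replace hρ₂ := ae_of_ae_map m₂.aemeasurable hρ₂
  rw [Measure.map_map (by fun_prop) m₁] at hs₁
  rw [Measure.map_map (by fun_prop) m₂] at hs₂
  have hsub : Measurable fun p : (ℕ → ℝ) × (ℕ → ℝ) => weightedSq fun j => p.1 j - p.2 j :=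
    hw.comp (by fun_prop)
  have hevp : Measurable fun p : (((ℕ → ℝ) × (ℕ → ℝ)) × W) × (Y × Y) => (e p.2.1, e p.2.2) := by
    fun_prop
  let D₀ : (((ℕ → ℝ) × (ℕ → ℝ)) × W) × (Y × Y) → ℝ≥0∞ :=
    fun p => weightedSq fun j => p.1.1.1 j - p.1.1.2 j
  let D : (((ℕ → ℝ) × (ℕ → ℝ)) × W) × (Y × Y) → ℝ≥0∞ :=
    fun p => weightedSq fun j => e p.2.1 j - e p.2.2 j
  have hD₀m : Measurable D₀ := hsub.comp (by fun_prop : Measurable fun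
    p : (((ℕ → ℝ) × (ℕ → ℝ)) × W) × (Y × Y) => p.1.1)
  have hle : D ≤ᵐ[Γ] D₀ := by
    filter_upwards [hρ₁, hρ₂] with p h1 h2 using hG h1 h2
  have hD₀ : ∫⁻ p, D₀ p ∂Γ = ∫⁻ p, weightedSq (fun j => p.1 j - p.2 j) ∂γ := by
    rw [← hΓγ, lintegral_map hsub (by fun_prop)]
  have hfin : ∫⁻ p, D₀ p ∂Γ ≠ ∞ := by
    rw [hD₀]
    refine ne_top_of_le_ne_top ?_ (lintegral_mono fun p => weightedSq_sub_le p.1 p.2)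
    rw [lintegral_add_left (by fun_prop), lintegral_const_mul _ (by fun_prop),
      lintegral_const_mul _ (by fun_prop), ← lintegral_map hw measurable_fst,
      ← lintegral_map hw measurable_snd, hγ₁, hγ₂]
    exact ENNReal.add_ne_top.2 ⟨ENNReal.mul_ne_top (by simp) hm₁, ENNReal.mul_ne_top (by simp) hm₂⟩
  -- Stationarity makes the time-`T` pair a competitor in the minimization that defines `γ`.
  have hge : ∫⁻ p, D₀ p ∂Γ ≤ ∫⁻ p, D p ∂Γ := by
    rw [hD₀]
    have h1 := hmin (Γ.map fun p => (e p.2.1, e p.2.2))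
      (by rw [Measure.map_map measurable_fst hevp]; exact hs₁)
      (by rw [Measure.map_map measurable_snd hevp]; exact hs₂)
    rwa [lintegral_map hsub hevp] at h1
  have heq : D =ᵐ[Γ] D₀ :=
    ae_eq_of_ae_le_of_lintegral_le hle (ne_top_of_le_ne_top hfin (lintegral_mono_ae hle))
      hD₀m.aemeasurable hge
  have huv : (fun p => p.2.1) =ᵐ[Γ] fun p => p.2.2 := by
    filter_upwards [hρ₁, hρ₂, heq, ae_lt_top hD₀m hfin] with p h1 h2 h3 h4
      using hGeq h1 h2 h4.ne h3
  rw [← hΓ₁, ← hΓ₂, Measure.map_map measurable_snd m₁, Measure.map_map measurable_snd m₂]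
  exact Measure.map_congr huv

theorem exists_common_bound {x y : ℕ → ℝ}
    (hx : ∃ B : ℕ, ∀ n, ∑ j ∈ Finset.range n, x j ^ 2 ≤ (B : ℝ))
    (hy : ∃ B : ℕ, ∀ n, ∑ j ∈ Finset.range n, y j ^ 2 ≤ (B : ℝ)) :
    ∃ B : ℝ, (∀ n, ∑ j ∈ Finset.range n, x j ^ 2 ≤ B) ∧
      ∀ n, ∑ j ∈ Finset.range n, y j ^ 2 ≤ B := by
  obtain ⟨B, hB⟩ := hx
  obtain ⟨B', hB'⟩ := hy
  exact ⟨max B B', fun n => (hB n).trans (le_max_left _ _), fun n => (hB' n).trans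
    (le_max_right _ _)⟩

theorem measurable_extendPath_apply {T : ℝ} (hT : 0 ≤ T) (t : ℝ) :
    Measurable fun (v : ℕ → C(Icc 0 T, ℝ)) j => extendPath hT v j t :=
  measurable_pi_lambda _ fun j => ((continuous_extendPath_uncurry hT j).comp
    (by fun_prop : Continuous fun v : ℕ → C(Icc 0 T, ℝ) => (v, t))).measurable

/-- Two stationary laws of solutions of the dyadic system with the same noise law coincide. -/
theorem map_snd_eq_of_stationary {r σ T : ℝ} (hr : 1 ≤ r) (hT : 0 < T) {q : ℕ → ℝ}
    (hq : Icc 0 T ⊆ closure (range q)) {μ₁ μ₂ κ : Measure (ℕ → ℝ)} [IsProbabilityMeasure μ₁]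
    [IsProbabilityMeasure μ₂] [IsProbabilityMeasure κ]
    {ρ₁ ρ₂ : Measure (((ℕ → ℝ) × (ℕ → ℝ)) × (ℕ → C(Icc 0 T, ℝ)))} [IsProbabilityMeasure ρ₁]
    [IsProbabilityMeasure ρ₂] (hρ₁ : ∀ᵐ p ∂ρ₁, p ∈ solutionSet r σ hT.le q)
    (hρ₂ : ∀ᵐ p ∂ρ₂, p ∈ solutionSet r σ hT.le q) (hf₁ : ρ₁.map Prod.fst = μ₁.prod κ)
    (hf₂ : ρ₂.map Prod.fst = μ₂.prod κ) (hs₁ : ρ₁.map (fun p j => extendPath hT.le p.2 j T) = μ₁)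
    (hs₂ : ρ₂.map (fun p j => extendPath hT.le p.2 j T) = μ₂)
    (hm₁ : ∫⁻ x, weightedSq x ∂μ₁ ≠ ∞) (hm₂ : ∫⁻ x, weightedSq x ∂μ₂ ≠ ∞) :
    ρ₁.map Prod.snd = ρ₂.map Prod.snd := by
  refine map_snd_eq_of_contracting (measurable_extendPath_apply hT.le T) (fun h1 h2 => ?_)
    (fun h1 h2 h3 h4 => ?_) hρ₁ hρ₂ hf₁ hf₂ hs₁ hs₂ hm₁ hm₂
  · obtain ⟨B, hx, hy⟩ := exists_common_bound h1.1 h2.1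
    exact (isCoupledPair_of_mem_solutionSet hq h1 h2).weightedSq_le hr hT.le hx hy
  · obtain ⟨B, hx, hy⟩ := exists_common_bound h1.1 h2.1
    funext j
    ext t
    have := (isCoupledPair_of_mem_solutionSet hq h1 h2).eqOn_of_weightedSq_eq hr hT hx hy h3
      h4 j t.2
    rwa [extendPath_of_mem hT.le _ _ t.2, extendPath_of_mem hT.le _ _ t.2] at this

/-! ### Law of the noise and its independence of the initial condition -/

section Brownian

variable {Ω : Type*} [mΩ : MeasurableSpace Ω] {P : Measure Ω}

theorem indepFun_prodMk_right_of_indepFun_prodMk {A B C : Type*} [MeasurableSpace A]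
    [MeasurableSpace B] [MeasurableSpace C] [IsProbabilityMeasure P] {X : Ω → A} {Y : Ω → B} {Z : Ω → C}
    (hX : Measurable X) (hY : Measurable Y) (hZ : Measurable Z) (h : IndepFun X Y P)
    (h' : IndepFun (fun ω => (X ω, Y ω)) Z P) : IndepFun X (fun ω => (Y ω, Z ω)) P := by
  have hYZ : IndepFun Y Z P := h'.comp measurable_snd measurable_id
  rw [indepFun_iff_map_prod_eq_prod_map_map hX.aemeasurable (by fun_prop)]
  rw [indepFun_iff_map_prod_eq_prod_map_map (by fun_prop) (by fun_prop)] at h h' hYZ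
  rw [hYZ, ← Measure.prodAssoc_prod, ← h, ← h', Measure.map_map (by fun_prop) (by fun_prop)]
  rfl

variable {T : ℝ≥0} {𝓕 : Filtration ℝ≥0 mΩ} {W : ℝ≥0 → Ω → ℝ}

namespace IsBrownianWrt

theorem measurable_eval (h : IsBrownianWrt T P 𝓕 W) {t : ℝ≥0} (ht : t ≤ T) : Measurable (W t) :=
  (h.adapted t ht).mono (𝓕.le t) le_rfl

theorem indepFun_finset [IsProbabilityMeasure P] (h : IsBrownianWrt T P 𝓕 W) {A : Type*} [MeasurableSpace A] {ξ : Ω → A}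
    (hξ : Measurable[𝓕 0] ξ) (s : Finset ℝ≥0) (hs : ∀ t ∈ s, t ≤ T) :
    IndepFun ξ (fun ω (t : s) => W t ω) P := by
  have hξm : Measurable ξ := hξ.mono (𝓕.le 0) le_rfl
  induction s using Finset.induction_on_max with
  | empty =>
    have : (fun ω (t : (∅ : Finset ℝ≥0)) => W t ω) = fun _ _ => (0 : ℝ) := by
      funext ω t; exact absurd t.2 (Finset.notMem_empty _)
    rw [this]
    exact indepFun_const_right _ _
  | insert a s has ih =>
    have ih := ih fun t ht => hs t (Finset.mem_insert_of_mem ht)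
    have haT : a ≤ T := hs a (Finset.mem_insert_self _ _)
    have hsT : ∀ t ∈ s, t ≤ T := fun t ht => hs t (Finset.mem_insert_of_mem ht)
    -- The last earlier time. For empty `s` this is `0`, where `W` vanishes almost surely, so `W a`
    -- is recovered from the increment in either case.
    set b : ℝ≥0 := s.sup id with hb
    have hba : b ≤ a := Finset.sup_le fun t ht => (has t ht).le
    have hbT : b ≤ T := hba.trans haT
    have hsb : ∀ t ∈ s, t ≤ b := fun t ht => Finset.le_sup (f := id) ht
    have hsm : Measurable[𝓕 b] fun ω (t : s) => W t ω :=
      @measurable_pi_lambda _ _ _ (𝓕 b) _ _ fun t =>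
        (h.adapted t (hsT t t.2)).mono (𝓕.mono (hsb t t.2)) le_rfl
    have hinc : IndepFun (fun ω => (ξ ω, fun t : s => W t ω)) (fun ω => W a ω - W b ω) P := by
      refine (indep_of_indep_of_le_right (h.indep b a hba haT) ?_).symm
      have hξb : Measurable[𝓕 b] ξ := hξ.mono (𝓕.mono zero_le) le_rfl
      have hp : Measurable[𝓕 b] fun ω => (ξ ω, fun t : s => W t ω) := hξb.prodMk hsm
      exact hp.comap_le
    have hprod := indepFun_prodMk_right_of_indepFun_prodMk hξm (hsm.mono (𝓕.le b) le_rfl)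
      ((h.measurable_eval haT).sub (h.measurable_eval hbT)) ih hinc
    let g : (s → ℝ) × ℝ → ↥(insert a s : Finset ℝ≥0) → ℝ := fun p t =>
      if ht : t.1 ∈ s then p.1 ⟨t.1, ht⟩
      else (if hbs : b ∈ s then p.1 ⟨b, hbs⟩ else 0) + p.2
    have hg : Measurable g := by
      refine measurable_pi_lambda _ fun t => ?_
      simp only [g]
      split_ifs <;> fun_prop
    refine (hprod.comp measurable_id hg).congr (.refl _ _) ?_
    filter_upwards [h.isBrownian.eval_zero_ae_eq_zero] with ω h0
    funext t
    simp only [Function.comp_apply, g, Pi.sub_apply]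
    split_ifs with ht hbs
    · rfl
    · have : t.1 = a := (Finset.mem_insert.1 t.2).resolve_right ht
      rw [this]; ring
    · have : t.1 = a := (Finset.mem_insert.1 t.2).resolve_right ht
      have hb0 : b = 0 := by
        rcases s.eq_empty_or_nonempty with rfl | hne
        · simp [hb]
        · refine absurd ?_ hbs
          obtain ⟨c, hc, hcb⟩ := Finset.exists_mem_eq_sup s hne id
          rw [hb, hcb]; exact hc
      rw [this, hb0, h0]; ring

theorem indepFun_process [IsProbabilityMeasure P] (h : IsBrownianWrt T P 𝓕 W) {A : Type*} [MeasurableSpace A] {ξ : Ω → A}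
    (hξ : Measurable[𝓕 0] ξ) : IndepFun ξ (fun ω (t : Iic T) => W t ω) P := by
  refine IndepFun.indepFun_process (hξ.mono (𝓕.le 0) le_rfl) (fun t => h.measurable_eval t.2)
    fun J => ?_
  have h1 := h.indepFun_finset hξ (J.map (Function.Embedding.subtype _)) (by
    intro t ht
    obtain ⟨t', -, rfl⟩ := Finset.mem_map.1 ht
    exact t'.2)
  let g : (J.map (Function.Embedding.subtype _) → ℝ) → J → ℝ :=
    fun x t => x ⟨t.1.1, Finset.mem_map_of_mem _ t.2⟩
  have hg : Measurable g := measurable_pi_lambda _ fun t => measurable_pi_apply _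
  exact h1.comp measurable_id hg

end IsBrownianWrt

theorem map_restrict_isBrownianReal {W : ℝ≥0 → Ω → ℝ} (h : IsBrownianReal W P) (q : ℕ → ℝ≥0)
    (J : Finset ℕ) : P.map (fun ω => J.restrict fun n => W (q n) ω) =
      (BrownianReal.projectiveFamily (J.image q)).map
        fun x (n : J) => x ⟨q n, Finset.mem_image_of_mem q n.2⟩ := by
  rw [← (h.hasLaw (J.image q)).map_eq, AEMeasurable.map_map_of_aemeasurable
    (Measurable.aemeasurable (by fun_prop)) (h.hasLaw (J.image q)).aemeasurable]
  rfl

/-- Two Brownian motions have the same law along every sequence of times. -/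
theorem map_isBrownianReal_eq {Ω₁ Ω₂ : Type*} [MeasurableSpace Ω₁] [MeasurableSpace Ω₂]
    {P₁ : Measure Ω₁} {P₂ : Measure Ω₂} [IsProbabilityMeasure P₁] [IsProbabilityMeasure P₂]
    {W₁ : ℝ≥0 → Ω₁ → ℝ} {W₂ : ℝ≥0 → Ω₂ → ℝ} (h₁ : IsBrownianReal W₁ P₁)
    (h₂ : IsBrownianReal W₂ P₂) (q : ℕ → ℝ≥0) :
    P₁.map (fun ω n => W₁ (q n) ω) = P₂.map (fun ω n => W₂ (q n) ω) := by
  have m₁ : AEMeasurable (fun ω n => W₁ (q n) ω) P₁ :=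
    aemeasurable_pi_lambda _ fun n => h₁.aemeasurable _
  have m₂ : AEMeasurable (fun ω n => W₂ (q n) ω) P₂ :=
    aemeasurable_pi_lambda _ fun n => h₂.aemeasurable _
  have : ∀ J : Finset ℕ, IsFiniteMeasure (P₁.map fun ω => J.restrict fun n => W₁ (q n) ω) :=
    fun J => inferInstance
  refine (isProjectiveLimit_map (X := fun n => W₁ (q n)) m₁).unique fun J => ?_
  change _ = P₁.map (fun ω => J.restrict fun n => W₁ (q n) ω)
  rw [map_restrict_isBrownianReal h₁, ← map_restrict_isBrownianReal h₂]
  exact isProjectiveLimit_map (X := fun n => W₂ (q n)) m₂ J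

end Brownian

/-! ### Measurability for `ℓ²` and for paths -/

/-- The sequence of the components of an element of `ℓ²`. -/
def components (x : EllTwo) : ℕ → ℝ := fun j => x j

theorem continuous_components : Continuous components :=
  (lp.uniformContinuous_coe (E := fun _ : ℕ => ℝ) (p := 2)).continuous

theorem injective_components : Function.Injective components := fun _ _ h => lp.ext h

instance instSecondCountableTopologyEllTwo : SecondCountableTopology EllTwo := by
  have hs : TopologicalSpace.IsSeparable
      (closure (Submodule.span ℝ (range fun i : ℕ => (lp.single 2 i (1 : ℝ) : EllTwo)) :
        Set EllTwo)) :=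
    (countable_range _).isSeparable.span.closure
  have hu : closure (Submodule.span ℝ (range fun i : ℕ => (lp.single 2 i (1 : ℝ) : EllTwo)) :
      Set EllTwo) = univ := by
    refine eq_univ_of_forall fun x => ?_
    have h := lp.hasSum_single (E := fun _ : ℕ => ℝ) (p := 2) ENNReal.ofNat_ne_top x
    refine mem_closure_of_tendsto h (Eventually.of_forall fun s => ?_)
    refine Submodule.sum_mem _ fun i _ => ?_
    have e : (lp.single 2 i (x i) : EllTwo) = (x i : ℝ) • (lp.single 2 i (1 : ℝ) : EllTwo) := by
      rw [← lp.single_smul (𝕜 := ℝ) (E := fun _ : ℕ => ℝ)]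
      exact congrArg (fun a : ℝ => (lp.single 2 i a : EllTwo)) (_root_.mul_one (x i)).symm
    rw [e]
    exact Submodule.smul_mem _ _ (Submodule.subset_span (mem_range_self i))
  rw [hu] at hs
  have := TopologicalSpace.isSeparable_univ_iff.1 hs
  exact UniformSpace.secondCountable_of_separable EllTwo

/-- By Lusin–Souslin, a continuous injection between Polish spaces is a measurable embedding; so the
Borel σ-algebra of `ℓ²` is generated by the coordinates. -/
theorem measurableEmbedding_components : MeasurableEmbedding components :=
  continuous_components.measurable.measurableEmbedding injective_components

theorem sum_sq_le_norm_sq (x : EllTwo) (n : ℕ) :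
    ∑ j ∈ Finset.range n, x j ^ 2 ≤ ‖x‖ ^ 2 := by
  have := lp.sum_rpow_le_norm_rpow (E := fun _ : ℕ => ℝ) (p := 2) (by norm_num) x
    (Finset.range n)
  simp only [ENNReal.toReal_ofNat, Real.rpow_two, Real.norm_eq_abs, sq_abs] at this
  exact this

theorem weightedSq_components_le (x : EllTwo) :
    weightedSq (components x) ≤ ENNReal.ofReal (‖x‖ ^ 2) := by
  refine ENNReal.tsum_le_of_sum_range_le fun n => ?_
  rw [← ENNReal.ofReal_sum_of_nonneg fun j _ => by positivity]
  refine ENNReal.ofReal_le_ofReal ((Finset.sum_le_sum fun j _ => ?_).trans (sum_sq_le_norm_sq x n))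
  exact mul_le_of_le_one_left (sq_nonneg _) (pow_le_one₀ (by norm_num) (by norm_num))

theorem measurable_of_measurable_eval {Ω : Type*} [MeasurableSpace Ω] {T : ℝ} (hT : 0 ≤ T)
    {f : Ω → C(Icc 0 T, ℝ)} (hf : ∀ t, Measurable fun ω => f ω t) : Measurable f := by
  have : Nonempty (Icc 0 T) := ⟨⟨0, le_rfl, hT⟩⟩
  have hc : Continuous fun (g : C(Icc 0 T, ℝ)) n => g (TopologicalSpace.denseSeq (Icc 0 T) n) := by
    fun_prop
  have hi : Function.Injective
      fun (g : C(Icc 0 T, ℝ)) n => g (TopologicalSpace.denseSeq (Icc 0 T) n) := fun g h hgh =>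
    DFunLike.coe_injective <| g.continuous.ext_on (TopologicalSpace.denseRange_denseSeq _)
      h.continuous (by rintro _ ⟨n, rfl⟩; exact congrFun hgh n)
  refine (hc.measurable.measurableEmbedding hi).measurable_comp_iff.1 ?_
  exact measurable_pi_lambda _ fun n => hf _

/-- The components are continuous only almost surely, so the path is set to `0` on a measurable null
set containing the exceptional points. -/
theorem exists_measurable_path {Ω : Type*} [MeasurableSpace Ω] {P : Measure Ω} {T : ℝ} (hT : 0 ≤ T)
    {f : ℕ → ℝ → Ω → ℝ} (hf : ∀ j, ∀ t ∈ Icc 0 T, Measurable (f j t))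
    (hc : ∀ᵐ ω ∂P, ∀ j, ContinuousOn (fun t => f j t ω) (Icc 0 T)) :
    ∃ U : Ω → ℕ → C(Icc 0 T, ℝ), Measurable U ∧ ∀ᵐ ω ∂P, ∀ j t, U ω j t = f j t ω := by
  classical
  obtain ⟨N, hN, hNm, hN0⟩ := exists_measurable_superset_of_null (ae_iff.1 hc)
  have hcN : ∀ ω ∉ N, ∀ j, ContinuousOn (fun t => f j t ω) (Icc 0 T) := fun ω hω => by
    by_contra h
    exact hω (hN h)
  refine ⟨fun ω j => if h : ω ∉ N then ⟨fun t => f j t ω, (hcN ω h j).domRestrict⟩ else 0,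
    measurable_pi_lambda _ fun j => measurable_of_measurable_eval hT fun t => ?_, ?_⟩
  · have e : (fun ω => (if h : ω ∉ N then
        (⟨fun t : Icc 0 T => f j t ω, (hcN ω h j).domRestrict⟩ : C(Icc 0 T, ℝ)) else 0) t)
        = fun ω => if ω ∈ N then 0 else f j t ω := by
      funext ω
      by_cases h : ω ∈ N
      · simp [h]
      · simp only [h, not_false_eq_true, dif_pos, if_false]
        rfl
    rw [e]
    exact Measurable.ite hNm measurable_const (hf j t t.2)
  · filter_upwards [compl_mem_ae_iff.2 hN0] with ω hω j t
    have : ω ∉ N := hω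
    simp only [this, not_false_eq_true, dif_pos]
    rfl

theorem IsPathSolution.mem_solutionSet {c σ T : ℝ} (hT : 0 ≤ T) {x : EllTwo} {w : ℝ → ℝ}
    {v : ℝ → EllTwo} (h : IsPathSolution c σ T x w v) {U : ℕ → C(Icc 0 T, ℝ)}
    (hU : ∀ j (t : Icc 0 T), U j t = v t j) {q : ℕ → ℝ} (hq : ∀ n, q n ∈ Icc 0 T) :
    ((components x, fun n => w (q n)), U) ∈ solutionSet (2 ^ c) σ hT q := by
  have hext : ∀ j, ∀ t ∈ Icc 0 T, extendPath hT U j t = v t j := fun j t ht => by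
    rw [extendPath_of_mem hT U j ht, hU]
  have hcont := continuous_extendPath hT U
  have h0 : (0 : ℝ) ∈ Icc 0 T := ⟨le_rfl, hT⟩
  refine ⟨?_, fun n => ?_, hcont, fun j t => ?_, fun j t ht => ?_⟩
  · obtain ⟨B, hB⟩ := exists_nat_ge (‖x‖ ^ 2)
    exact ⟨B, fun n => (sum_sq_le_norm_sq x n).trans hB⟩
  · have e : ∫ s in (0 : ℝ)..q n, -(extendPath hT U 0 s * extendPath hT U 1 s) =
        -∫ s in (0 : ℝ)..q n, v s 0 * v s 1 := by
      rw [← intervalIntegral.integral_neg]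
      refine intervalIntegral.integral_congr fun s hs => ?_
      rw [uIcc_of_le (hq n).1] at hs
      have hs' : s ∈ Icc 0 T := ⟨hs.1, hs.2.trans (hq n).2⟩
      simp only [hext _ s hs']
    simp only
    rw [hext 0 _ (hq n), h.eq_zero _ (hq n), e, h.initial, components]
    ring
  · unfold extendPath
    rw [hU]
    exact h.mem_Hplus _ (projIcc 0 T hT t).2 (j + 1) (by lia)
  · have hd : Continuous (drift (2 ^ c) (extendPath hT U) j) := by
      unfold drift; fun_prop
    have h1 := integral_eq_sub_of_hasDerivAt_Ioo (f := extendPath hT U (j + 1))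
      (g := drift (2 ^ c) (extendPath hT U) j) (T := T) (hcont _) hd (fun s hs => ?_) ht
    · rw [h1, hext _ 0 h0, h.initial]
      simp [components]
    · have hs' := Ioo_subset_Icc_self hs
      have h2 := (h.eq_pos (j + 1) (by lia) s hs').hasDerivAt (Icc_mem_nhds hs.1 hs.2)
      have h3 : HasDerivAt (extendPath hT U (j + 1)) _ s := h2.congr_of_eventuallyEq (by
        filter_upwards [Icc_mem_nhds hs.1 hs.2] with z hz using hext _ z hz)
      convert h3 using 1
      simp only [drift, hext _ s hs', Nat.add_sub_cancel]
      rw [← Real.rpow_natCast, ← Real.rpow_natCast, ← Real.rpow_mul zero_le_two,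
        ← Real.rpow_mul zero_le_two]
      push_cast
      simp only [add_sub_cancel_right, Nat.add_assoc, Nat.reduceAdd]

/-- Meant for product spaces over the uncountable set of times: there it is enough that the
σ-algebra is pulled back along `f`, with no measurable embedding required. -/
theorem measure_eq_of_map_eq {A B : Type*} [mA : MeasurableSpace A] [mB : MeasurableSpace B]
    {f : A → B} (hf : mA = mB.comap f) {μ ν : Measure A} (h : μ.map f = ν.map f) : μ = ν := by
  have hm : Measurable f := fun s hs => by rw [hf]; exact ⟨s, hs, rfl⟩
  ext s hs
  rw [hf] at hs
  obtain ⟨t, ht, rfl⟩ := hs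
  rw [← Measure.map_apply hm ht, h, Measure.map_apply hm ht]

theorem measurableSpace_pi_ellTwo_eq_comap (ι : Type*) :
    (MeasurableSpace.pi : MeasurableSpace (ι → EllTwo)) =
      (MeasurableSpace.pi : MeasurableSpace (ι → ℕ → ℝ)).comap fun y t => components (y t) := by
  simp only [MeasurableSpace.pi, MeasurableSpace.comap_iSup, MeasurableSpace.comap_comp]
  refine iSup_congr fun t => ?_
  rw [← measurableEmbedding_components.comap_eq, MeasurableSpace.pi, MeasurableSpace.comap_comp,
    MeasurableSpace.comap_iSup]
  simp only [MeasurableSpace.comap_comp]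
  rfl

/-! ### Joint law of a stationary solution and conclusion -/

theorem exists_dense_times (T : ℝ≥0) :
    ∃ q : ℕ → ℝ≥0, (∀ n, q n ≤ T) ∧ Icc (0 : ℝ) T ⊆ closure (range fun n => (q n : ℝ)) := by
  have : Nonempty (Icc (0 : ℝ) T) := ⟨⟨0, le_rfl, T.coe_nonneg⟩⟩
  refine ⟨fun n => ⟨TopologicalSpace.denseSeq (Icc (0 : ℝ) T) n,
    (TopologicalSpace.denseSeq (Icc (0 : ℝ) T) n).2.1⟩,
    fun n => (TopologicalSpace.denseSeq (Icc (0 : ℝ) T) n).2.2, ?_⟩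
  have h := continuous_subtype_val.range_subset_closure_image_dense
    (TopologicalSpace.denseRange_denseSeq (Icc (0 : ℝ) T))
  rwa [Subtype.range_coe, ← range_comp] at h

/-- The joint law of the initial condition, of the noise at the times `q n` and of the path of a
strong stationary solution. -/
theorem IsStrongStationarySolution.exists_joint_law {Ω : Type*} [mΩ : MeasurableSpace Ω]
    {P : Measure Ω} [IsProbabilityMeasure P] {T : ℝ≥0} {σ : ℝ≥0} {c : ℝ}
    {𝓕 : Filtration ℝ≥0 mΩ} {W : ℝ≥0 → Ω → ℝ} {ξ : Ω → EllTwo} {u : ℝ≥0 → Ω → EllTwo}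
    (h : IsStrongStationarySolution c σ T P 𝓕 W ξ u) (hL : InL2Hplus T P u) {q : ℕ → ℝ≥0}
    (hq : ∀ n, q n ≤ T) :
    ∃ ρ : Measure (((ℕ → ℝ) × (ℕ → ℝ)) × (ℕ → C(Icc (0 : ℝ) T, ℝ))), IsProbabilityMeasure ρ ∧
      (∀ᵐ p ∂ρ, p ∈ solutionSet (2 ^ c) σ T.coe_nonneg fun n => (q n : ℝ)) ∧
      (∃ μ : Measure (ℕ → ℝ), IsProbabilityMeasure μ ∧
        ρ.map Prod.fst = μ.prod (P.map fun ω n => W (q n) ω) ∧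
        ρ.map (fun p j => extendPath T.coe_nonneg p.2 j T) = μ ∧ ∫⁻ x, weightedSq x ∂μ ≠ ∞) ∧
      (ρ.map Prod.snd).map (fun v (t : Iic T) j => extendPath T.coe_nonneg v j t) =
        P.map fun ω (t : Iic T) => components (u t ω) := by
  have hT0 : (0 : ℝ) ≤ T := T.coe_nonneg
  have hm : ∀ t ≤ T, Measurable fun ω => components (u t ω) := fun t ht =>
    continuous_components.measurable.comp (h.strong.measurable t ht)
  obtain ⟨U, hU, hUe⟩ := exists_measurable_path (P := P) hT0
    (f := fun j t ω => components (u t.toNNReal ω) j)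
    (fun j t ht => (measurable_pi_apply j).comp (hm _ (Real.toNNReal_le_iff_le_coe.2 ht.2)))
    (by filter_upwards [h.strong.solves] with ω hω j using hω.continuousOn j)
  have hξF := h.strong.initial_measurable
  have hξ : Measurable fun ω => components (ξ ω) :=
    continuous_components.measurable.comp (hξF.mono (𝓕.le 0) le_rfl)
  have hW : Measurable fun ω n => W (q n) ω :=
    measurable_pi_lambda _ fun n => h.strong.brownian.measurable_eval (hq n)
  have hZ : Measurable fun ω => ((components (ξ ω), fun n => W (q n) ω), U ω) :=
    (hξ.prodMk hW).prodMk hU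
  have hξu : ξ =ᵐ[P] u 0 := by
    filter_upwards [h.strong.solves] with ω hω
    simpa using hω.initial.symm
  have hUt : ∀ᵐ ω ∂P, ∀ t ≤ T, (fun j => extendPath T.coe_nonneg (U ω) j t) = components (u t ω) := by
    filter_upwards [hUe] with ω hω t ht
    funext j
    rw [extendPath_of_mem T.coe_nonneg _ _ ⟨t.coe_nonneg, NNReal.coe_le_coe.2 ht⟩, hω]
    simp
  -- Stationarity is used here between times `0` and `T`, to give the start and end of the path the
  -- same law.
  have hlaw : P.map (fun ω => components (ξ ω)) = P.map fun ω => components (u T ω) := by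
    have h1 := h.stationary 0 zero_le T le_rfl
    rw [← Measure.map_congr hξu] at h1
    have h2 := congrArg (Measure.map components) h1
    rwa [Measure.map_map continuous_components.measurable (hξF.mono (𝓕.le 0) le_rfl),
      Measure.map_map continuous_components.measurable (h.strong.measurable T le_rfl)] at h2
  refine ⟨P.map fun ω => ((components (ξ ω), fun n => W (q n) ω), U ω),
    Measure.isProbabilityMeasure_map hZ.aemeasurable, ?_,
    ⟨P.map fun ω => components (ξ ω), Measure.isProbabilityMeasure_map hξ.aemeasurable,
      ?_, ?_, ?_⟩, ?_⟩
  · refine (ae_map_iff hZ.aemeasurable (measurableSet_solutionSet _ _ _ _)).2 ?_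
    filter_upwards [h.strong.solves, hUe] with ω hω hUω
    have := hω.mem_solutionSet hT0 (U := U ω) hUω (q := fun n => (q n : ℝ))
      fun n => ⟨(q n).coe_nonneg, NNReal.coe_le_coe.2 (hq n)⟩
    simp only [Real.toNNReal_coe] at this
    exact this
  · rw [Measure.map_map measurable_fst hZ]
    have hind := h.strong.brownian.indepFun_process hξF
    have hg : Measurable fun (x : Iic T → ℝ) n => x ⟨q n, hq n⟩ := by fun_prop
    exact (indepFun_iff_map_prod_eq_prod_map_map hξ.aemeasurable hW.aemeasurable).1
      (hind.comp continuous_components.measurable hg)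
  · have he : Measurable fun (p : ((ℕ → ℝ) × (ℕ → ℝ)) × (ℕ → C(Icc (0 : ℝ) T, ℝ))) j =>
        extendPath T.coe_nonneg p.2 j T :=
      (measurable_extendPath_apply T.coe_nonneg T).comp measurable_snd
    rw [Measure.map_map he hZ, hlaw]
    refine Measure.map_congr ?_
    filter_upwards [hUt] with ω hω using hω T le_rfl
  · rw [hlaw, lintegral_map measurable_weightedSq (hm T le_rfl)]
    have h2 := (hL T le_rfl).2.integrable_norm_pow two_ne_zero
    refine ne_top_of_le_ne_top h2.lintegral_lt_top.ne (lintegral_mono fun ω => ?_)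
    exact weightedSq_components_le _
  · have he : Measurable fun (v : ℕ → C(Icc (0 : ℝ) T, ℝ)) (t : Iic T) j =>
        extendPath T.coe_nonneg v j t :=
      measurable_pi_lambda _ fun t => measurable_extendPath_apply T.coe_nonneg t
    rw [Measure.map_map measurable_snd hZ, Measure.map_map he (measurable_snd.comp hZ)]
    refine Measure.map_congr ?_
    filter_upwards [hUt] with ω hω
    funext t
    exact hω t t.2

end Dyadic

theorem theorem3p3 {Ω₁ : Type*} {Ω₂ : Type*} [mΩ₁ : MeasurableSpace Ω₁] [mΩ₂ : MeasurableSpace Ω₂]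
    (P₁ : Measure Ω₁) [IsProbabilityMeasure P₁] (P₂ : Measure Ω₂) [IsProbabilityMeasure P₂]
    (T : ℝ≥0) (hT : 0 < T) (σ : ℝ≥0) (c : ℝ) (hc : c ∈ Set.Ico (1 : ℝ) 3)
    (𝓕₁ : Filtration ℝ≥0 mΩ₁) (W₁ : ℝ≥0 → Ω₁ → ℝ)
    (ξ₁ : Ω₁ → Dyadic.EllTwo) (u₁ : ℝ≥0 → Ω₁ → Dyadic.EllTwo)
    (𝓕₂ : Filtration ℝ≥0 mΩ₂) (W₂ : ℝ≥0 → Ω₂ → ℝ)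
    (ξ₂ : Ω₂ → Dyadic.EllTwo) (u₂ : ℝ≥0 → Ω₂ → Dyadic.EllTwo)
    (hu₁ : Dyadic.IsStrongStationarySolution c σ T P₁ 𝓕₁ W₁ ξ₁ u₁)
    (hu₂ : Dyadic.IsStrongStationarySolution c σ T P₂ 𝓕₂ W₂ ξ₂ u₂)
    (hL₁ : Dyadic.InL2Hplus T P₁ u₁) (hL₂ : Dyadic.InL2Hplus T P₂ u₂) :
    -- the stationary one-time laws on `ℓ²` agree
    (∀ t ≤ T, P₁.map (u₁ t) = P₂.map (u₂ t)) ∧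
    -- and so do the laws of the processes on the path space `(ℓ²)^[0, T]`
    P₁.map (fun ω (t : Set.Iic T) => u₁ t ω) = P₂.map (fun ω (t : Set.Iic T) => u₂ t ω) := by
  have m₁ : Measurable fun ω (t : Set.Iic T) => u₁ t ω :=
    measurable_pi_lambda _ fun t => hu₁.strong.measurable t t.2
  have m₂ : Measurable fun ω (t : Set.Iic T) => u₂ t ω :=
    measurable_pi_lambda _ fun t => hu₂.strong.measurable t t.2
  have key : P₁.map (fun ω (t : Set.Iic T) => u₁ t ω) =
      P₂.map (fun ω (t : Set.Iic T) => u₂ t ω) := by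
    obtain ⟨q, hqT, hq⟩ := Dyadic.exists_dense_times T
    obtain ⟨ρ₁, hρ₁, hS₁, ⟨μ₁, hμ₁, hf₁, hs₁, hm₁⟩, he₁⟩ := hu₁.exists_joint_law hL₁ hqT
    obtain ⟨ρ₂, hρ₂, hS₂, ⟨μ₂, hμ₂, hf₂, hs₂, hm₂⟩, he₂⟩ := hu₂.exists_joint_law hL₂ hqT
    -- The two noises live on different spaces but have one law along `q`, which lets the gluing use
    -- a single noise.
    rw [← Dyadic.map_isBrownianReal_eq hu₁.strong.brownian.isBrownian
      hu₂.strong.brownian.isBrownian q] at hf₂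
    have hW : IsProbabilityMeasure (P₁.map fun ω n => W₁ (q n) ω) :=
      Measure.isProbabilityMeasure_map (aemeasurable_pi_lambda _ fun n =>
        hu₁.strong.brownian.isBrownian.aemeasurable _)
    have hr : (1 : ℝ) ≤ 2 ^ c := Real.one_le_rpow one_le_two (zero_le_one.trans hc.1)
    have hlaw := Dyadic.map_snd_eq_of_stationary hr (NNReal.coe_pos.2 hT) hq hS₁ hS₂ hf₁ hf₂
      hs₁ hs₂ hm₁ hm₂
    refine Dyadic.measure_eq_of_map_eq (Dyadic.measurableSpace_pi_ellTwo_eq_comap _) ?_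
    have hcm : Measurable fun (y : Set.Iic T → Dyadic.EllTwo) t => Dyadic.components (y t) :=
      measurable_pi_lambda _ fun t =>
        Dyadic.continuous_components.measurable.comp (measurable_pi_apply t)
    rw [Measure.map_map hcm m₁, Measure.map_map hcm m₂]
    refine he₁.symm.trans (Eq.trans ?_ he₂)
    rw [hlaw]
  refine ⟨fun t ht => ?_, key⟩
  have h := congrArg (Measure.map fun x : Set.Iic T → Dyadic.EllTwo => x ⟨t, ht⟩) key
  rwa [Measure.map_map (measurable_pi_apply _) m₁, Measure.map_map (measurable_pi_apply _) m₂] at h
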